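/- Let $d \in \mathbb{N}$, let $\Omega = [0,1]^d$ be the $d$-dimensional torus (opposite points identified), let $T>0$, and let $f \in C_c^\infty(\mathbb{R})$ be real-valued, acting by composition, $f(u)(x) = f(u(x))$. All functions on $\Omega$ are real-valued. For $k \in \mathbb{N}$ let $H^k(\Omega)$ denote the space of functions in $L^2(\Omega)$ whose (periodic) weak partial derivatives up to order $k$ lie in $L^2(\Omega)$, and set $H^{-1}(\Omega) = (H^1(\Omega))^*$, with $L^2(\Omega) \subset H^{-1}(\Omega)$ via $u \mapsto \langle u, \cdot\rangle_{L^2}$. For $\theta \in L^2(\Omega)$ consider the periodic reaction-diffusion equation $$\frac{\partial}{\partial t} u - \Delta u = f(u) \ \text{ on } (0,T] \times \Omega, \qquad u(0,\cdot) = \theta \ \text{ on } \Omega.$$ A weak solution is a map $u \in L^2([0,T], H^1(\Omega)) \cap C([0,T], L^2(\Omega))$ with $u(0)=\theta$ and with weak time derivative $u' = \frac{\partial}{\partial t} u \in L^2([0,T], H^{-1}(\Omega))$ such that $$\langle u'(t), v \rangle + \langle \nabla u(t), \nabla v \rangle_{L^2} = \langle f(u(t)), v \rangle_{L^2} \quad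 \text{for all } v \in H^1(\Omega) \text{ and a.e. } t \in (0,T],$$ where $\langle u'(t), v\rangle$ is the pairing between $H^{-1}(\Omega)$ and $H^1(\Omega)$. A weak solution is called a strong solution if in addition $u \in L^2([0,T], H^2(\Omega)) \cap C([0,T], H^1(\Omega))$ and $u' \in L^2([0,T], L^2(\Omega))$. Theorem. For every such $d$, $T$, $f$ and every $\theta \in H^1(\Omega)$ there exists a strong solution $u = u_\theta$ of this equation, and it is unique in $C([0,T], L^2(\Omega))$: every weak solution $v$ with the same initial condition $\theta$ satisfies $v(t) = u(t)$ in $L^2(\Omega)$ for all $t \in [0,T]$. -/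

import Mathlib

open MeasureTheory Set
open scoped ContDiff

noncomputable section

namespace ReactionDiffusion

/-! ### The flat torus and its smooth functions -/

/-- Lebesgue (= normalised Haar) measure on the torus `[0,1]^d` with opposite sides identified. -/
abbrev torusMeasure (d : ℕ) : Measure (UnitAddTorus (Fin d)) :=
  Measure.pi fun _ => (AddCircle.haarAddCircle : Measure UnitAddCircle)

/-- The real Hilbert space `L²(Ω)`. -/
abbrev L2 (d : ℕ) : Type := Lp ℝ 2 (torusMeasure d)

/-- The quotient map `ℝ^d → Ω`. -/
def toTorus {d : ℕ} (x : Fin d → ℝ) : UnitAddTorus (Fin d) := fun i => (x i : UnitAddCircle)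

/-- `φ ∈ C^∞(Ω)`: the periodic function on `ℝ^d` induced by `φ` is infinitely differentiable. -/
def IsSmooth {d : ℕ} (φ : UnitAddTorus (Fin d) → ℝ) : Prop :=
  ContDiff ℝ ∞ fun x : Fin d → ℝ => φ (toTorus x)

/-- The classical partial derivative `∂φ/∂x_i` of a function on the torus. -/
def pderiv {d : ℕ} (i : Fin d) (φ : UnitAddTorus (Fin d) → ℝ) (x : UnitAddTorus (Fin d)) : ℝ :=
  deriv (fun s : ℝ => φ (x + Pi.single i (s : UnitAddCircle))) 0

lemma isOpenQuotientMap_toTorus (d : ℕ) :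
    IsOpenQuotientMap (toTorus : (Fin d → ℝ) → UnitAddTorus (Fin d)) :=
  IsOpenQuotientMap.piMap fun _ => QuotientAddGroup.isOpenQuotientMap_mk

lemma IsSmooth.continuous {d : ℕ} {φ : UnitAddTorus (Fin d) → ℝ} (hφ : IsSmooth φ) :
    Continuous φ :=
  (isOpenQuotientMap_toTorus d).isQuotientMap.continuous_iff.2 (ContDiff.continuous hφ)

lemma IsSmooth.pderiv_toTorus {d : ℕ} {φ : UnitAddTorus (Fin d) → ℝ} (hφ : IsSmooth φ)
    (i : Fin d) (x : Fin d → ℝ) :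
    pderiv i φ (toTorus x) =
      fderiv ℝ (fun y : Fin d → ℝ => φ (toTorus y)) x (Pi.single i 1) := by
  have h1 : (fun s : ℝ => φ (toTorus x + Pi.single i (s : UnitAddCircle))) =
      fun s : ℝ => (fun y : Fin d → ℝ => φ (toTorus y)) (x + s • Pi.single i 1) := by
    funext s
    have : toTorus x + Pi.single i (s : UnitAddCircle) =
        toTorus (x + s • (Pi.single i 1 : Fin d → ℝ)) := by
      funext j
      by_cases hj : j = i
      · subst hj; simp [toTorus]
      · simp [toTorus, Pi.single_eq_of_ne hj]
    simp only [this]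
  unfold pderiv
  rw [h1]
  have hd : DifferentiableAt ℝ (fun y : Fin d → ℝ => φ (toTorus y)) x :=
    (hφ.differentiable (by simp)).differentiableAt
  exact hd.lineDeriv_eq_fderiv

lemma IsSmooth.pderiv {d : ℕ} {φ : UnitAddTorus (Fin d) → ℝ} (hφ : IsSmooth φ) (i : Fin d) :
    IsSmooth (pderiv i φ) := by
  have h : (fun x : Fin d → ℝ => ReactionDiffusion.pderiv i φ (toTorus x)) =
      fun x => fderiv ℝ (fun y : Fin d → ℝ => φ (toTorus y)) x (Pi.single i 1) :=
    funext (hφ.pderiv_toTorus i)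
  unfold IsSmooth
  rw [h]
  exact (hφ.fderiv_right (m := ∞) (by simp)).clm_apply contDiff_const

lemma integrable_mul_continuous {d : ℕ} (u : L2 d) {ψ : UnitAddTorus (Fin d) → ℝ}
    (hψ : Continuous ψ) : Integrable (fun x => u x * ψ x) (torusMeasure d) := by
  have hu : Integrable (fun x => u x) (torusMeasure d) := (Lp.memLp u).integrable (by norm_num)
  obtain ⟨C, hC⟩ := isCompact_univ.exists_bound_of_continuousOn hψ.continuousOn
  exact hu.mul_bdd (c := C) hψ.aestronglyMeasurable (Filter.Eventually.of_forall fun x => hC x (mem_univ x))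

/-! ### Weak derivatives and Sobolev spaces on the torus -/

/-- `g ∈ L²(Ω)` is the weak partial derivative of `u ∈ L²(Ω)` in direction `i`. -/
def IsWeakPartial {d : ℕ} (i : Fin d) (u g : L2 d) : Prop :=
  ∀ φ : UnitAddTorus (Fin d) → ℝ, IsSmooth φ →
    ∫ x, u x * pderiv i φ x ∂(torusMeasure d) = -∫ x, g x * φ x ∂(torusMeasure d)

lemma IsWeakPartial.zero {d : ℕ} (i : Fin d) : IsWeakPartial i (0 : L2 d) 0 := by
  intro φ _
  have h : ∀ ψ : UnitAddTorus (Fin d) → ℝ,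
      ∫ x, (0 : L2 d) x * ψ x ∂(torusMeasure d) = 0 := fun ψ => by
    rw [integral_congr_ae (g := fun _ => (0 : ℝ)), integral_zero]
    filter_upwards [Lp.coeFn_zero ℝ 2 (torusMeasure d)] with x hx
    rw [hx, Pi.zero_apply, zero_mul]
  rw [h, h, neg_zero]

lemma integral_add_mul {d : ℕ} (u v : L2 d) {ψ : UnitAddTorus (Fin d) → ℝ} (hψ : Continuous ψ) :
    ∫ x, (u + v) x * ψ x ∂(torusMeasure d) =
      ∫ x, u x * ψ x ∂(torusMeasure d) + ∫ x, v x * ψ x ∂(torusMeasure d) := by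
  rw [← integral_add (integrable_mul_continuous u hψ) (integrable_mul_continuous v hψ)]
  refine integral_congr_ae ?_
  filter_upwards [Lp.coeFn_add u v] with x hx
  simp only [hx, Pi.add_apply]
  ring

lemma integral_smul_mul {d : ℕ} (c : ℝ) (u : L2 d) (ψ : UnitAddTorus (Fin d) → ℝ) :
    ∫ x, (c • u) x * ψ x ∂(torusMeasure d) = c * ∫ x, u x * ψ x ∂(torusMeasure d) := by
  rw [← integral_const_mul]
  refine integral_congr_ae ?_
  filter_upwards [Lp.coeFn_smul c u] with x hx
  simp only [hx, Pi.smul_apply, smul_eq_mul]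
  ring

lemma IsWeakPartial.add {d : ℕ} {i : Fin d} {u v g h : L2 d} (hu : IsWeakPartial i u g)
    (hv : IsWeakPartial i v h) : IsWeakPartial i (u + v) (g + h) := by
  intro φ hφ
  rw [integral_add_mul u v (hφ.pderiv i).continuous, integral_add_mul g h hφ.continuous,
    hu φ hφ, hv φ hφ]
  ring

lemma IsWeakPartial.smul {d : ℕ} {i : Fin d} {u g : L2 d} (c : ℝ) (hu : IsWeakPartial i u g) :
    IsWeakPartial i (c • u) (c • g) := by
  intro φ hφ
  rw [integral_smul_mul, integral_smul_mul, hu φ hφ]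
  ring

/-- The Sobolev space `H¹(Ω)`, realised as the space of all `(u, (∂_1 u, …, ∂_d u))` with `u` and
its weak partial derivatives in `L²(Ω)`; norm `(‖u‖² + ∑ i, ‖∂_i u‖²)^{1/2}`. Since weak
derivatives are unique, an element is determined by its first component. -/
def H1Submodule (d : ℕ) : Submodule ℝ (WithLp 2 (L2 d × PiLp 2 fun _ : Fin d => L2 d)) where
  carrier := {p | ∀ i, IsWeakPartial i p.fst (p.snd i)}
  add_mem' hp hq i := (hp i).add (hq i)
  zero_mem' i := IsWeakPartial.zero i
  smul_mem' c _ hp i := (hp i).smul c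

/-- The Hilbert space `H¹(Ω)`. -/
abbrev H1 (d : ℕ) : Type := H1Submodule d

/-- The inclusion `H¹(Ω) → L²(Ω)`. -/
def H1.toL2 {d : ℕ} : H1 d →L[ℝ] L2 d :=
  (WithLp.fstL 2 ℝ (L2 d) (PiLp 2 fun _ : Fin d => L2 d)).comp (H1Submodule d).subtypeL

/-- The weak partial derivative `∂_i v` of `v ∈ H¹(Ω)`. -/
def H1.partial {d : ℕ} (v : H1 d) (i : Fin d) : L2 d := v.1.snd i

/-- The Sobolev space `H²(Ω)`, realised as the space of all `(u, (∂_1 u, …, ∂_d u))` with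
`u ∈ L²(Ω)` and weak partial derivatives `∂_i u` in `H¹(Ω)`; norm
`(‖u‖² + ∑ i, ‖∂_i u‖² + ∑ i j, ‖∂_j ∂_i u‖²)^{1/2}`. -/
def H2Submodule (d : ℕ) : Submodule ℝ (WithLp 2 (L2 d × PiLp 2 fun _ : Fin d => H1 d)) where
  carrier := {p | ∀ i, IsWeakPartial i p.fst (H1.toL2 (p.snd i))}
  add_mem' {p q} hp hq i := by
    have h : H1.toL2 ((p + q).snd i) = H1.toL2 (p.snd i) + H1.toL2 (q.snd i) :=
      map_add H1.toL2 _ _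
    rw [h]
    exact (hp i).add (hq i)
  zero_mem' i := by
    have h : H1.toL2 ((0 : WithLp 2 (L2 d × PiLp 2 fun _ : Fin d => H1 d)).snd i) = 0 :=
      map_zero H1.toL2
    rw [h]
    exact IsWeakPartial.zero i
  smul_mem' c p hp i := by
    have h : H1.toL2 ((c • p).snd i) = c • H1.toL2 (p.snd i) := map_smul H1.toL2 c _
    rw [h]
    exact (hp i).smul c

/-- The Hilbert space `H²(Ω)`. -/
abbrev H2 (d : ℕ) : Type := H2Submodule d

/-- The inclusion `H²(Ω) → L²(Ω)`. -/
def H2.toL2 {d : ℕ} : H2 d →L[ℝ] L2 d :=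
  (WithLp.fstL 2 ℝ (L2 d) (PiLp 2 fun _ : Fin d => H1 d)).comp (H2Submodule d).subtypeL

/-- The dual space `H⁻¹(Ω) = (H¹(Ω))*`. -/
abbrev HNeg1 (d : ℕ) : Type := StrongDual ℝ (H1 d)

/-- The embedding `L²(Ω) → H⁻¹(Ω)`, `u ↦ ⟨u, ·⟩_{L²}`. -/
def L2.toHNeg1 {d : ℕ} (u : L2 d) : HNeg1 d := (innerSL ℝ u).comp H1.toL2

/-! ### Functions of time with values in a normed space

Functions of time are maps on `ℝ`; only their values on `[0,T]` matter. -/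

/-- `u ∈ L²([0,T], X)`. -/
def MemL2Time {X : Type*} [NormedAddCommGroup X] (T : ℝ) (u : ℝ → X) : Prop :=
  MemLp u 2 (volume.restrict (Icc 0 T))

/-- `w` is the weak time derivative of `u` on `(0,T)`, both with values in `X`. -/
def IsWeakTimeDeriv {X : Type*} [NormedAddCommGroup X] [NormedSpace ℝ X] (T : ℝ) (u w : ℝ → X) :
    Prop :=
  IntegrableOn u (Icc 0 T) ∧ IntegrableOn w (Icc 0 T) ∧
    ∀ φ : ℝ → ℝ, ContDiff ℝ ∞ φ → HasCompactSupport φ → tsupport φ ⊆ Ioo 0 T →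
      ∫ t in Icc 0 T, deriv φ t • u t = -∫ t in Icc 0 T, φ t • w t

/-! ### Solutions of the reaction-diffusion equation -/

/-- `u` is a weak solution on `[0,T] × Ω` of `∂u/∂t - Δu = f(u)`, `u(0) = θ`:
`u ∈ L²([0,T], H¹) ∩ C([0,T], L²)` has a weak time derivative `u' ∈ L²([0,T], H⁻¹)`, and
`⟨u', v⟩ + ⟨∇u, ∇v⟩ = ⟨f(u), v⟩` for all `v ∈ H¹` and almost every `t`, where `f` acts by
composition. Here `U` is `u` as a function with values in `H¹`, and `w` is `u'`. -/
structure IsWeakSolution {d : ℕ} (f : ℝ → ℝ) (T : ℝ) (θ : L2 d) (u : ℝ → L2 d) : Prop where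
  continuousOn : ContinuousOn u (Icc 0 T)
  initial : u 0 = θ
  weak_eq : ∃ (U : ℝ → H1 d) (w : ℝ → HNeg1 d),
    MemL2Time T U ∧ (∀ᵐ t ∂volume.restrict (Icc 0 T), H1.toL2 (U t) = u t) ∧
    MemL2Time T w ∧ IsWeakTimeDeriv T (fun t => L2.toHNeg1 (u t)) w ∧
    ∀ v : H1 d, ∀ᵐ t ∂volume.restrict (Icc 0 T),
      w t v + ∑ i, inner ℝ ((U t).partial i) (v.partial i) =
        ∫ x, f (u t x) * H1.toL2 v x ∂(torusMeasure d)

/-- `u` is a strong solution: a weak solution such that moreover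
`u ∈ L²([0,T], H²) ∩ C([0,T], H¹)` and `u' ∈ L²([0,T], L²)`. -/
structure IsStrongSolution {d : ℕ} (f : ℝ → ℝ) (T : ℝ) (θ : L2 d) (u : ℝ → L2 d) : Prop extends
    IsWeakSolution f T θ u where
  memL2_H2 : ∃ U : ℝ → H2 d, MemL2Time T U ∧
    ∀ᵐ t ∂volume.restrict (Icc 0 T), H2.toL2 (U t) = u t
  continuousOn_H1 : ∃ U : ℝ → H1 d, ContinuousOn U (Icc 0 T) ∧
    ∀ t ∈ Icc 0 T, H1.toL2 (U t) = u t
  deriv_memL2 : ∃ w : ℝ → L2 d, MemL2Time T w ∧ IsWeakTimeDeriv T u w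

end ReactionDiffusion

end

/-!
On the torus the Laplacian is diagonal in the real orthonormal basis of Hartley functions
`h_n(x) = cos (2π n⋅x) + sin (2π n⋅x)`, `n ∈ ℤ^d`: one has `∂_i h_n = 2π n_i h_{-n}`, hence
`-Δ h_n = λ_n h_n` with `λ_n = 4π²|n|²`. Completeness of the basis follows from that of the complex
exponentials (`span_hartleyL2_orthogonal`).

For a right-hand side `g` which is continuous in time with values in `L²`, the equation
`u' - Δ u = g` decouples into the scalar equations `c' + λ_n c = g_n`, solved by Duhamel's formula.
Multiplying the scalar equation by `λ_n c` gives the energy estimate `duhamel_energy`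
`λ_n c(t)² + λ_n² ∫ c² ≤ λ_n c(0)² + ∫ g_n²`. Its right-hand side is summable in `n` when
`u(0) ∈ H¹`, by Bessel's inequality for the weak derivatives of `u(0)`. Since the Hartley functions
are orthogonal in `H¹` and their derivatives are again Hartley functions, the series for `u`
converges uniformly in time in `H¹` and in mean square in `H²`, and the series for `u'` in mean
square in `L²` (`mild_continuousOn`, `mild_memL2Time`, `mild_deriv_memL2Time`). So a mild solution
which starts in `H¹` is a strong solution (`isStrongSolution_of_mild`).

A smooth compactly supported `f` is Lipschitz, so it acts on `L²` by a Lipschitz map, and some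
iterate of the Picard map `u ↦ mild solution with right-hand side f(u)` is a contraction of
`C([0,T], L²)` (`existsUnique_mild`). This gives existence. For uniqueness, the weak equation tested
with `h_n` says that the `n`-th coefficient of a weak solution has a continuous weak derivative; by
the lemma of du Bois-Reymond it solves the scalar equation classically, so a weak solution is a
fixed point of the Picard map (`IsWeakSolution.eq_mild`).
-/

noncomputable section

namespace ReactionDiffusion

open Filter Topology

/-! ### The scalar equation `c' + l c = q` -/

/-- Duhamel's formula: the solution `c` of the scalar equation `c' + l c = q`, `c 0 = a`. -/
def duhamel (l a : ℝ) (q : ℝ → ℝ) (t : ℝ) : ℝ :=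
  Real.exp (-(l * t)) * (a + ∫ s in (0 : ℝ)..t, Real.exp (l * s) * q s)

lemma duhamel_zero (l a : ℝ) (q : ℝ → ℝ) : duhamel l a q 0 = a := by
  simp [duhamel]

lemma hasDerivAt_integral_continuous {q : ℝ → ℝ} (hq : Continuous q) (t : ℝ) :
    HasDerivAt (fun t => ∫ s in (0 : ℝ)..t, q s) (q t) t :=
  intervalIntegral.integral_hasDerivAt_right (hq.intervalIntegrable _ _)
    (hq.stronglyMeasurableAtFilter _ _) hq.continuousAt

lemma duhamel_hasDerivAt (l a : ℝ) {q : ℝ → ℝ} (hq : Continuous q) (t : ℝ) :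
    HasDerivAt (duhamel l a q) (-l * duhamel l a q t + q t) t := by
  have h1 : HasDerivAt (fun t => a + ∫ s in (0 : ℝ)..t, Real.exp (l * s) * q s)
      (Real.exp (l * t) * q t) t :=
    (hasDerivAt_integral_continuous (by fun_prop) t).const_add a
  have h2 : HasDerivAt (fun t : ℝ => Real.exp (-(l * t))) (Real.exp (-(l * t)) * -(l * 1)) t :=
    (((hasDerivAt_id t).const_mul l).neg).exp
  refine (h2.mul h1).congr_deriv ?_
  have h3 : Real.exp (-(l * t)) * Real.exp (l * t) = 1 := by
    rw [← Real.exp_add]; simp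
  unfold duhamel
  linear_combination q t * h3

lemma duhamel_continuous (l a : ℝ) {q : ℝ → ℝ} (hq : Continuous q) :
    Continuous (duhamel l a q) :=
  continuous_iff_continuousAt.2 fun t => (duhamel_hasDerivAt l a hq t).continuousAt

lemma duhamel_sub (l a : ℝ) {q r : ℝ → ℝ} (hq : Continuous q) (hr : Continuous r) (t : ℝ) :
    duhamel l a q t - duhamel l a r t = duhamel l 0 (fun s => q s - r s) t := by
  have h : ∫ s in (0 : ℝ)..t, Real.exp (l * s) * (q s - r s) =
      (∫ s in (0 : ℝ)..t, Real.exp (l * s) * q s) - ∫ s in (0 : ℝ)..t, Real.exp (l * s) * r s := by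
    rw [← intervalIntegral.integral_sub]
    · simp only [mul_sub]
    · exact Continuous.intervalIntegrable (by fun_prop) _ _
    · exact Continuous.intervalIntegrable (by fun_prop) _ _
  unfold duhamel
  rw [h]
  ring

lemma le_add_integral_of_hasDerivAt {y y' r : ℝ → ℝ} (hr : Continuous r)
    (hy : ∀ t, HasDerivAt y (y' t) t) (hle : ∀ t, 0 ≤ t → y' t ≤ r t) {t : ℝ} (ht : 0 ≤ t) :
    y t ≤ y 0 + ∫ s in (0 : ℝ)..t, r s := by
  have hd : ∀ t, HasDerivAt (fun t => y t - ∫ s in (0 : ℝ)..t, r s) (y' t - r t) t := fun t =>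
    (hy t).sub (hasDerivAt_integral_continuous hr t)
  have hanti : AntitoneOn (fun t => y t - ∫ s in (0 : ℝ)..t, r s) (Ici 0) := by
    refine antitoneOn_of_deriv_nonpos (convex_Ici 0)
      (fun t _ => (hd t).continuousAt.continuousWithinAt)
      (fun t _ => (hd t).differentiableAt.differentiableWithinAt) fun t ht => ?_
    rw [interior_Ici] at ht
    rw [(hd t).deriv]
    linarith [hle t (le_of_lt ht)]
  have := hanti self_mem_Ici ht ht
  simp only [intervalIntegral.integral_same] at this
  linarith

/-- A bound for one mode which is uniform in `l ≥ 0`. -/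
lemma duhamel_sq_le {l : ℝ} (hl : 0 ≤ l) (a : ℝ) {q : ℝ → ℝ} (hq : Continuous q) {t : ℝ}
    (ht : 0 ≤ t) :
    duhamel l a q t ^ 2 ≤ Real.exp t * (a ^ 2 + ∫ s in (0 : ℝ)..t, q s ^ 2) := by
  have h := le_add_integral_of_hasDerivAt (y := fun t => Real.exp (-t) * duhamel l a q t ^ 2)
    (r := fun s => q s ^ 2) (by fun_prop)
    (fun t => ((hasDerivAt_id t).neg.exp).mul ((duhamel_hasDerivAt l a hq t).pow 2)) ?_ ht
  · simp only [neg_zero, Real.exp_zero, duhamel_zero, one_mul] at h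
    have h3 : Real.exp t * Real.exp (-t) = 1 := by rw [← Real.exp_add]; simp
    calc duhamel l a q t ^ 2 = Real.exp t * (Real.exp (-t) * duhamel l a q t ^ 2) := by
          rw [← mul_assoc, h3, one_mul]
      _ ≤ _ := by gcongr
  · intro s hs
    have he : Real.exp (-s) ≤ 1 := Real.exp_le_one_iff.2 (by linarith)
    have he' : 0 ≤ Real.exp (-s) := (Real.exp_pos _).le
    set c := duhamel l a q s
    -- `2qc - 2lc² - c² ≤ q²`, multiplied by the weight `e^{-s} ≤ 1`
    have h1 : Real.exp (-s) * (2 * c * (-l * c + q s) - c ^ 2) ≤ Real.exp (-s) * q s ^ 2 := by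
      gcongr
      nlinarith [sq_nonneg (c - q s), mul_nonneg hl (sq_nonneg c)]
    have h2 : Real.exp (-s) * q s ^ 2 ≤ q s ^ 2 := by nlinarith [sq_nonneg (q s)]
    simp only [Pi.neg_apply, Pi.pow_apply, id_eq, Nat.cast_ofNat, Nat.add_one_sub_one, pow_one]
    linarith

/-- The energy (maximal regularity) estimate for one mode, from multiplying the equation by
`l c`. -/
lemma duhamel_energy (l a : ℝ) {q : ℝ → ℝ} (hq : Continuous q) {t : ℝ}
    (ht : 0 ≤ t) :
    l * duhamel l a q t ^ 2 + l ^ 2 * ∫ s in (0 : ℝ)..t, duhamel l a q s ^ 2 ≤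
      l * a ^ 2 + ∫ s in (0 : ℝ)..t, q s ^ 2 := by
  have hc := duhamel_continuous l a hq
  have h := le_add_integral_of_hasDerivAt
    (y := fun t => l * duhamel l a q t ^ 2 + l ^ 2 * ∫ s in (0 : ℝ)..t, duhamel l a q s ^ 2)
    (r := fun s => q s ^ 2) (by fun_prop)
    (fun t => (((duhamel_hasDerivAt l a hq t).pow 2).const_mul l).add
      ((hasDerivAt_integral_continuous (q := fun s => duhamel l a q s ^ 2)
        (by fun_prop) t).const_mul (l ^ 2))) ?_ ht
  · simpa [duhamel_zero] using h
  · intro s hs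
    simp only [Nat.cast_ofNat, Nat.add_one_sub_one, pow_one]
    nlinarith [sq_nonneg (l * duhamel l a q s - q s)]

lemma integral_deriv_duhamel_sq_le {l : ℝ} (hl : 0 ≤ l) (a : ℝ) {q : ℝ → ℝ} (hq : Continuous q)
    {t : ℝ} (ht : 0 ≤ t) :
    ∫ s in (0 : ℝ)..t, (-l * duhamel l a q s + q s) ^ 2 ≤
      2 * (l * a ^ 2) + 4 * ∫ s in (0 : ℝ)..t, q s ^ 2 := by
  have hc := duhamel_continuous l a hq
  have h1 := duhamel_energy l a hq ht
  have h2 : ∫ s in (0 : ℝ)..t, (-l * duhamel l a q s + q s) ^ 2 ≤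
      ∫ s in (0 : ℝ)..t, (2 * l ^ 2 * duhamel l a q s ^ 2 + 2 * q s ^ 2) := by
    refine intervalIntegral.integral_mono_on ht (Continuous.intervalIntegrable (by fun_prop) _ _)
      (Continuous.intervalIntegrable (by fun_prop) _ _) fun s _ => ?_
    nlinarith [sq_nonneg (l * duhamel l a q s + q s)]
  rw [intervalIntegral.integral_add (Continuous.intervalIntegrable (by fun_prop) _ _)
    (Continuous.intervalIntegrable (by fun_prop) _ _), intervalIntegral.integral_const_mul,
    intervalIntegral.integral_const_mul] at h2
  nlinarith [mul_nonneg hl (sq_nonneg (duhamel l a q t))]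

/-- Uniqueness for the scalar equation in integrated form. -/
lemma eqOn_duhamel {l T : ℝ} {p q : ℝ → ℝ} (hp : Continuous p) (hq : Continuous q)
    (h : ∀ t ∈ Icc 0 T, p t = p 0 + ∫ s in (0 : ℝ)..t, (-l * p s + q s)) :
    ∀ t ∈ Icc 0 T, p t = duhamel l (p 0) q t := by
  set P : ℝ → ℝ := fun t => p 0 + ∫ s in (0 : ℝ)..t, (-l * p s + q s) with hP
  have hPd : ∀ t, HasDerivAt P (-l * p t + q t) t := fun t =>
    (hasDerivAt_integral_continuous (q := fun s => -l * p s + q s) (by fun_prop) t).const_add _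
  set D : ℝ → ℝ := fun t => Real.exp (l * t) * (P t - duhamel l (p 0) q t) with hD
  have hDd : ∀ t, HasDerivAt D (Real.exp (l * t) * (l * (P t - p t))) t := fun t => by
    have h2 : HasDerivAt (fun t : ℝ => Real.exp (l * t)) (Real.exp (l * t) * (l * 1)) t :=
      (((hasDerivAt_id t).const_mul l)).exp
    refine (h2.mul ((hPd t).sub (duhamel_hasDerivAt l (p 0) hq t))).congr_deriv ?_
    simp only [Pi.sub_apply]
    ring
  intro t ht
  have hconst : D t = D 0 := by
    refine constant_of_has_deriv_right_zero (a := 0) (b := T)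
      (fun s _ => (hDd s).continuousAt.continuousWithinAt) (fun s hs => ?_) t ht
    have := (hDd s).hasDerivWithinAt (s := Ici s)
    rwa [show P s = p s from (h s ⟨hs.1, hs.2.le⟩).symm, sub_self, mul_zero, mul_zero] at this
  have h0 : D 0 = 0 := by simp [hD, hP, duhamel_zero]
  rw [h0] at hconst
  have := (mul_eq_zero.1 hconst).resolve_left (Real.exp_pos _).ne'
  rw [h t ht]
  linarith

/-! ### Square integrable curves and weak derivatives in time -/

lemma integral_Icc_eq {X : Type*} [NormedAddCommGroup X] [NormedSpace ℝ X] {T : ℝ} (hT : 0 ≤ T)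
    (g : ℝ → X) : ∫ t in Icc 0 T, g t = ∫ t in (0 : ℝ)..T, g t := by
  rw [integral_Icc_eq_integral_Ioc, intervalIntegral.integral_of_le hT]

/-- Integration by parts on `[0,T]` against a test function supported in `(0,T)`. -/
lemma integral_deriv_mul_eq_neg {T : ℝ} (hT : 0 ≤ T) {φ p p' : ℝ → ℝ} (hφ : ContDiff ℝ ∞ φ)
    (hsupp : tsupport φ ⊆ Ioo 0 T) (hp : ∀ t, HasDerivAt p (p' t) t) (hp' : Continuous p') :
    ∫ t in Icc 0 T, deriv φ t * p t = -∫ t in Icc 0 T, φ t * p' t := by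
  have h0 : ∀ x, x ∉ Ioo 0 T → φ x = 0 := fun x hx => image_eq_zero_of_notMem_tsupport
    fun h => hx (hsupp h)
  have hφd : ∀ t, HasDerivAt φ (deriv φ t) t := fun t =>
    ((hφ.differentiable (by simp)) t).hasDerivAt
  rw [integral_Icc_eq hT, integral_Icc_eq hT,
    intervalIntegral.integral_mul_deriv_eq_deriv_mul (u := φ) (v := p)
      (fun t _ => hφd t) (fun t _ => hp t)
      ((hφ.continuous_deriv (by simp)).intervalIntegrable _ _) (hp'.intervalIntegrable _ _),
    h0 T (by simp), h0 0 (by simp)]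
  ring

lemma IsWeakTimeDeriv.clm_comp {X Y : Type*} [NormedAddCommGroup X] [NormedSpace ℝ X]
    [CompleteSpace X] [NormedAddCommGroup Y] [NormedSpace ℝ Y] [CompleteSpace Y] {T : ℝ}
    {u w : ℝ → X} (h : IsWeakTimeDeriv T u w) (L : X →L[ℝ] Y) :
    IsWeakTimeDeriv T (fun t => L (u t)) (fun t => L (w t)) := by
  obtain ⟨hu, hw, h⟩ := h
  refine ⟨L.integrable_comp hu, L.integrable_comp hw, fun φ hφ hc hs => ?_⟩
  have hbd : ∀ ψ : ℝ → ℝ, Continuous ψ → ∀ v : ℝ → X, IntegrableOn v (Icc 0 T) →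
      IntegrableOn (fun t => ψ t • v t) (Icc 0 T) := fun ψ hψ v hv =>
    hv.continuousOn_smul hψ.continuousOn isCompact_Icc
  have h1 := L.integral_comp_comm (hbd _ (hφ.continuous_deriv (by simp)) u hu)
  have h2 := L.integral_comp_comm (hbd _ hφ.continuous w hw)
  simp only [map_smul] at h1 h2
  rw [h1, h2, h φ hφ hc hs, map_neg]

lemma IsWeakTimeDeriv.congr {X : Type*} [NormedAddCommGroup X] [NormedSpace ℝ X] {T : ℝ}
    {u u' w w' : ℝ → X} (h : IsWeakTimeDeriv T u w)
    (hu : u =ᵐ[volume.restrict (Icc 0 T)] u') (hw : w =ᵐ[volume.restrict (Icc 0 T)] w') :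
    IsWeakTimeDeriv T u' w' := by
  refine ⟨h.1.congr hu, h.2.1.congr hw, fun φ hφ hc hs => ?_⟩
  have h1 : ∫ t in Icc 0 T, deriv φ t • u t = ∫ t in Icc 0 T, deriv φ t • u' t :=
    integral_congr_ae (hu.mono fun t ht => by simp only [ht])
  have h2 : ∫ t in Icc 0 T, φ t • w t = ∫ t in Icc 0 T, φ t • w' t :=
    integral_congr_ae (hw.mono fun t ht => by simp only [ht])
  rw [← h1, ← h2, h.2.2 φ hφ hc hs]

/-- The dual `u ↦ ⟨u, L ·⟩` of a continuous linear map `L : X → H` into a Hilbert space; for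
`L = H1.toL2` this is the embedding `L² → H⁻¹`. -/
def innerComp {X H : Type*} [NormedAddCommGroup X] [NormedSpace ℝ X] [NormedAddCommGroup H]
    [InnerProductSpace ℝ H] (L : X →L[ℝ] H) : H →L[ℝ] StrongDual ℝ X :=
  LinearMap.mkContinuous
    { toFun := fun u => (innerSL ℝ u).comp L
      map_add' := fun u v => by ext w; simp
      map_smul' := fun c u => by ext w; simp }
    ‖L‖ fun u => by
      refine (ContinuousLinearMap.opNorm_comp_le _ _).trans_eq ?_
      rw [innerSL_apply_norm, mul_comm]

lemma MemL2Time.innerSL_comp {X H : Type*} [NormedAddCommGroup X] [NormedSpace ℝ X]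
    [NormedAddCommGroup H] [InnerProductSpace ℝ H] {T : ℝ} {w : ℝ → H} (hw : MemL2Time T w)
    (L : X →L[ℝ] H) : MemL2Time T fun t => (innerSL ℝ (w t)).comp L :=
  (innerComp L).comp_memLp' hw

lemma IsWeakTimeDeriv.innerSL_comp {X H : Type*} [NormedAddCommGroup X] [NormedSpace ℝ X]
    [NormedAddCommGroup H] [InnerProductSpace ℝ H] [CompleteSpace H] {T : ℝ} {u w : ℝ → H}
    (h : IsWeakTimeDeriv T u w) (L : X →L[ℝ] H) :
    IsWeakTimeDeriv T (fun t => (innerSL ℝ (u t)).comp L) fun t => (innerSL ℝ (w t)).comp L :=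
  h.clm_comp (innerComp L)

lemma memL2Time_toLp {T : ℝ} {κ Y Z : Type*} [Fintype κ] [NormedAddCommGroup Y]
    [NormedAddCommGroup Z] {u : ℝ → Y} {D : κ → ℝ → Z} (hu : MemL2Time T u)
    (hD : ∀ i, MemL2Time T (D i)) :
    MemL2Time T fun t => (WithLp.toLp 2 (u t, WithLp.toLp 2 fun i => D i t) :
      WithLp 2 (Y × PiLp 2 fun _ : κ => Z)) := by
  have hm : AEStronglyMeasurable (fun t => (WithLp.toLp 2 (u t, WithLp.toLp 2 fun i => D i t) :
      WithLp 2 (Y × PiLp 2 fun _ : κ => Z))) (volume.restrict (Icc 0 T)) := by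
    have h1 : AEStronglyMeasurable (fun t i => D i t) (volume.restrict (Icc 0 T)) := by
      classical
      have h2 : (fun t i => D i t) = fun t => ∑ i, (Pi.single i (D i t) : κ → Z) :=
        funext fun t => (Finset.univ_sum_single fun i => D i t).symm
      rw [h2]
      exact Finset.aestronglyMeasurable_fun_sum _ fun i _ =>
        (continuous_single i).comp_aestronglyMeasurable (hD i).1
    have h2 := (PiLp.continuous_toLp 2 fun _ : κ => Z).comp_aestronglyMeasurable h1
    exact (WithLp.prod_continuous_toLp 2 Y (PiLp 2 fun _ : κ => Z)).comp_aestronglyMeasurable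
      (hu.1.prodMk h2)
  have h1 : Integrable (fun t => ‖u t‖ ^ 2 + ∑ i, ‖D i t‖ ^ 2) (volume.restrict (Icc 0 T)) :=
    ((memLp_two_iff_integrable_sq_norm hu.1).1 hu).add
      (integrable_finsetSum _ fun i _ => (memLp_two_iff_integrable_sq_norm (hD i).1).1 (hD i))
  refine (memLp_two_iff_integrable_sq_norm hm).2 (h1.congr (Eventually.of_forall fun t => ?_))
  simp only
  rw [WithLp.prod_norm_sq_eq_of_L2, PiLp.norm_sq_eq_of_L2]
  rfl

lemma memL2Time_of_coe {T : ℝ} {X : Type*} [NormedAddCommGroup X] [Module ℝ X]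
    {S : Submodule ℝ X} {V : ℝ → S} (h : MemL2Time T fun t => (V t : X)) : MemL2Time T V :=
  MemLp.of_le h (Topology.IsEmbedding.subtypeVal.aestronglyMeasurable_comp_iff.1 h.1)
    (Eventually.of_forall fun _ => le_rfl)

lemma integral_eq_zero_of_tsupport_subset {α β s t : ℝ} {χ : ℝ → ℝ}
    (h : tsupport χ ⊆ Icc α β) (hst : (s ≤ α ∧ t ≤ α) ∨ (β ≤ s ∧ β ≤ t)) :
    ∫ x in s..t, χ x = 0 := by
  refine intervalIntegral.integral_zero_ae ?_
  have hα : ∀ᵐ x : ℝ, x ≠ α := by simp [ae_iff, measure_singleton]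
  have hβ : ∀ᵐ x : ℝ, x ≠ β := by simp [ae_iff, measure_singleton]
  filter_upwards [hα, hβ] with x h1 h2 hx
  refine image_eq_zero_of_notMem_tsupport fun hx' => ?_
  obtain ⟨h3, h4⟩ := h hx'
  rw [mem_uIoc] at hx
  rcases hst with h | h <;> rcases hx with hx | hx
  · exact h1 (le_antisymm (hx.2.trans h.2) h3)
  · exact h1 (le_antisymm (hx.2.trans h.1) h3)
  · exact absurd (h.1.trans_lt hx.1) (not_lt.2 h4)
  · exact absurd (h.2.trans_lt hx.1) (not_lt.2 h4)

/-- A test function with vanishing integral is the derivative of a test function. -/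
lemma exists_testFunction_deriv_eq {T : ℝ} (hT : 0 < T) {χ : ℝ → ℝ} (hχ : ContDiff ℝ ∞ χ)
    (hc : HasCompactSupport χ) (hs : tsupport χ ⊆ Ioo 0 T) (h0 : ∫ t in (0 : ℝ)..T, χ t = 0) :
    ∃ φ : ℝ → ℝ, ContDiff ℝ ∞ φ ∧ HasCompactSupport φ ∧ tsupport φ ⊆ Ioo 0 T ∧ deriv φ = χ := by
  have hK : IsCompact (insert (T / 2) (tsupport χ)) := IsCompact.insert hc _
  have hKs : insert (T / 2) (tsupport χ) ⊆ Ioo 0 T :=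
    insert_subset ⟨by linarith, by linarith⟩ hs
  obtain ⟨α, hα⟩ := hK.exists_isLeast ⟨_, mem_insert _ _⟩
  obtain ⟨β, hβ⟩ := hK.exists_isGreatest ⟨_, mem_insert _ _⟩
  have hsub : tsupport χ ⊆ Icc α β := fun x hx =>
    ⟨hα.2 (mem_insert_of_mem _ hx), hβ.2 (mem_insert_of_mem _ hx)⟩
  have hα0 := (hKs hα.1).1
  have hβT := (hKs hβ.1).2
  set φ : ℝ → ℝ := fun t => ∫ s in (0 : ℝ)..t, χ s
  have hd : ∀ t, HasDerivAt φ (χ t) t := hasDerivAt_integral_continuous hχ.continuous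
  have hderiv : deriv φ = χ := funext fun t => (hd t).deriv
  have hzero : ∀ t, t ∉ Icc α β → φ t = 0 := by
    intro t ht
    rcases lt_or_ge t α with h | h
    · exact integral_eq_zero_of_tsupport_subset hsub (Or.inl ⟨hα0.le, h.le⟩)
    · have hβt : β ≤ t := le_of_lt (not_le.1 fun h' => ht ⟨h, h'⟩)
      have h1 : ∫ s in T..t, χ s = 0 :=
        integral_eq_zero_of_tsupport_subset hsub (Or.inr ⟨hβT.le, hβt⟩)
      have h2 := intervalIntegral.integral_add_adjacent_intervals
        (hχ.continuous.intervalIntegrable (μ := volume) 0 T)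
        (hχ.continuous.intervalIntegrable (μ := volume) T t)
      rw [h0, h1, add_zero] at h2
      exact h2.symm
  have hts : tsupport φ ⊆ Icc α β :=
    closure_minimal (fun t ht => by_contra fun h => ht (hzero t h)) isClosed_Icc
  refine ⟨φ, ?_, HasCompactSupport.intro isCompact_Icc hzero, hts.trans (Icc_subset_Ioo hα0 hβT),
    hderiv⟩
  rw [contDiff_infty_iff_deriv, hderiv]
  exact ⟨fun t => (hd t).differentiableAt, hχ⟩

/-- The lemma of du Bois-Reymond: a continuous function with continuous weak derivative `r` is a
primitive of `r`. -/
lemma IsWeakTimeDeriv.eq_add_integral {T : ℝ} (hT : 0 < T) {p r : ℝ → ℝ} (hp : Continuous p)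
    (hr : Continuous r) (h : IsWeakTimeDeriv T p r) :
    ∀ t ∈ Icc 0 T, p t = p 0 + ∫ s in (0 : ℝ)..t, r s := by
  set R : ℝ → ℝ := fun t => ∫ s in (0 : ℝ)..t, r s
  have hRd : ∀ t, HasDerivAt R (r t) t := hasDerivAt_integral_continuous hr
  have hRc : Continuous R := continuous_iff_continuousAt.2 fun t => (hRd t).continuousAt
  set k : ℝ → ℝ := fun t => p t - R t with hk
  have hkc : Continuous k := hp.sub hRc
  have hk0 : ∀ φ : ℝ → ℝ, ContDiff ℝ ∞ φ → HasCompactSupport φ → tsupport φ ⊆ Ioo 0 T →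
      ∫ t in (0 : ℝ)..T, deriv φ t * k t = 0 := by
    intro φ hφ hφc hφs
    have h1 := h.2.2 φ hφ hφc hφs
    have h2 := integral_deriv_mul_eq_neg hT.le hφ hφs hRd hr
    have h3 := hφ.continuous_deriv (by simp)
    simp only [smul_eq_mul] at h1
    rw [integral_Icc_eq hT.le, integral_Icc_eq hT.le] at h1 h2
    simp only [hk, mul_sub]
    rw [intervalIntegral.integral_sub (Continuous.intervalIntegrable (by fun_prop) _ _)
      (Continuous.intervalIntegrable (by fun_prop) _ _), h1, h2, sub_self]
  -- `ρ` is a bump of integral one; `k` equals its `ρ`-average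
  let B : ContDiffBump (T / 2) := ⟨T / 8, T / 4, by positivity, by linarith⟩
  set ρ : ℝ → ℝ := B.normed volume
  have hρ : ContDiff ℝ ∞ ρ := B.contDiff_normed
  have hρs : tsupport ρ ⊆ Ioo 0 T := by
    rw [B.tsupport_normed_eq, Real.closedBall_eq_Icc]
    exact Icc_subset_Ioo (by simp only [B]; linarith) (by simp only [B]; linarith)
  have hρc : HasCompactSupport ρ := B.hasCompactSupport_normed
  have hint : ∀ χ : ℝ → ℝ, tsupport χ ⊆ Ioo 0 T →
      ∫ t in (0 : ℝ)..T, χ t = ∫ t, χ t := fun χ hχ => by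
    rw [intervalIntegral.integral_of_le hT.le]
    exact setIntegral_eq_integral_of_forall_compl_eq_zero fun x hx =>
      image_eq_zero_of_notMem_tsupport fun h => hx (Ioo_subset_Ioc_self (hχ h))
  have hρ1 : ∫ t in (0 : ℝ)..T, ρ t = 1 := (hint ρ hρs).trans B.integral_normed
  set c := ∫ t in (0 : ℝ)..T, ρ t * k t with hcdef
  have hae : ∀ᵐ t, t ∈ Ioo 0 T → k t - c = 0 := by
    refine isOpen_Ioo.ae_eq_zero_of_integral_contDiff_smul_eq_zero
      ((hkc.sub continuous_const).locallyIntegrable.locallyIntegrableOn _) fun ψ hψ hψc hψs => ?_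
    set m := ∫ t in (0 : ℝ)..T, ψ t with hm
    have hχs : tsupport (fun t => ψ t - m * ρ t) ⊆ tsupport ψ ∪ tsupport ρ := by
      refine closure_minimal (fun t ht => ?_)
        ((isClosed_tsupport ψ).union (isClosed_tsupport ρ))
      by_contra hn
      rw [mem_union, not_or] at hn
      exact ht (by simp [image_eq_zero_of_notMem_tsupport hn.1,
        image_eq_zero_of_notMem_tsupport hn.2])
    obtain ⟨φ, hφ, hφc, hφs, hφd⟩ := exists_testFunction_deriv_eq hT
      (χ := fun t => ψ t - m * ρ t) (hψ.sub (contDiff_const.mul hρ))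
      ((hψc.union hρc).of_isClosed_subset (isClosed_tsupport _) hχs)
      (hχs.trans (union_subset hψs hρs)) (by
        have h1 := hψ.continuous
        have h2 := hρ.continuous
        rw [intervalIntegral.integral_sub (Continuous.intervalIntegrable (by fun_prop) _ _)
          (Continuous.intervalIntegrable (by fun_prop) _ _), intervalIntegral.integral_const_mul,
          hρ1, ← hm]
        ring)
    have h1 := hψ.continuous
    have h2 := hρ.continuous
    have h3 := hk0 φ hφ hφc hφs
    rw [hφd] at h3
    have h4 : tsupport (fun t => ψ t * (k t - c)) ⊆ Ioo 0 T :=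
      (tsupport_mul_subset_left (f := ψ)).trans hψs
    simp only [smul_eq_mul]
    rw [← hint _ h4]
    have h5 : ∫ t in (0 : ℝ)..T, (ψ t - m * ρ t) * k t =
        (∫ t in (0 : ℝ)..T, ψ t * k t) - m * c := by
      rw [hcdef, ← intervalIntegral.integral_const_mul, ← intervalIntegral.integral_sub
        (Continuous.intervalIntegrable (by fun_prop) _ _)
        (Continuous.intervalIntegrable (by fun_prop) _ _)]
      congr 1
      funext t
      ring
    have h6 : ∫ t in (0 : ℝ)..T, ψ t * (k t - c) = (∫ t in (0 : ℝ)..T, ψ t * k t) - m * c := by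
      rw [hm, ← intervalIntegral.integral_mul_const, ← intervalIntegral.integral_sub
        (Continuous.intervalIntegrable (by fun_prop) _ _)
        (Continuous.intervalIntegrable (by fun_prop) _ _)]
      congr 1
      funext t
      ring
    rw [h6, ← h5, h3]
  have heq : EqOn k (fun _ => c) (Icc 0 T) := by
    refine Measure.eqOn_Icc_of_ae_eq volume hT.ne ?_ hkc.continuousOn continuousOn_const
    rw [← Measure.restrict_congr_set Ioo_ae_eq_Icc]
    refine (ae_restrict_iff' measurableSet_Ioo).2 ?_
    filter_upwards [hae] with t ht htm
    exact sub_eq_zero.1 (ht htm)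
  intro t ht
  have h1 := heq ht
  have h2 := heq (left_mem_Icc.2 hT.le)
  have h3 : R 0 = 0 := intervalIntegral.integral_same
  simp only [hk] at h1 h2
  rw [h3] at h2
  change p t = p 0 + R t
  linarith

/-! ### Orthogonal series with time-dependent coefficients -/

section Orthogonal

variable {ι X : Type*} [NormedAddCommGroup X] [InnerProductSpace ℝ X]

lemma norm_sq_sum_of_pairwise {v : ι → X} (hv : Pairwise fun i j => inner ℝ (v i) (v j) = 0)
    (s : Finset ι) : ‖∑ i ∈ s, v i‖ ^ 2 = ∑ i ∈ s, ‖v i‖ ^ 2 := by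
  classical
  induction s using Finset.induction_on with
  | empty => simp
  | insert i s hi ih =>
    have h : inner ℝ (v i) (∑ j ∈ s, v j) = 0 := by
      rw [inner_sum]
      exact Finset.sum_eq_zero fun j hj => hv fun h => hi (h ▸ hj)
    rw [Finset.sum_insert hi, Finset.sum_insert hi, norm_add_sq_real, h, ih]
    ring

lemma pairwise_smul {E : ι → X} (hE : Pairwise fun i j => inner ℝ (E i) (E j) = 0) (a : ι → ℝ) :
    Pairwise fun i j => inner ℝ (a i • E i) (a j • E j) = 0 := fun i j hij => by
  simp [inner_smul_left, inner_smul_right, hE hij]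

lemma norm_smul_sq {X : Type*} [NormedAddCommGroup X] [NormedSpace ℝ X] (a : ℝ) (x : X) :
    ‖a • x‖ ^ 2 = a ^ 2 * ‖x‖ ^ 2 := by
  rw [norm_smul, mul_pow, Real.norm_eq_abs, sq_abs]

end Orthogonal

section Pythagorean

variable {ι X : Type*} [NormedAddCommGroup X] [NormedSpace ℝ X]

/-- `E` is an orthogonal family with squared norms `w`. Orthogonality is expressed by Pythagoras'
identity for finite linear combinations, so that only the norm of the space enters. -/
def IsPythagorean (E : ι → X) (w : ι → ℝ) : Prop :=
  ∀ (s : Finset ι) (a : ι → ℝ), ‖∑ k ∈ s, a k • E k‖ ^ 2 = ∑ k ∈ s, a k ^ 2 * w k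

lemma isPythagorean_of_pairwise {Y : Type*} [NormedAddCommGroup Y] [InnerProductSpace ℝ Y]
    {E : ι → Y} (hE : Pairwise fun i j => inner ℝ (E i) (E j) = 0) :
    IsPythagorean E fun k => ‖E k‖ ^ 2 := fun s a => by
  rw [norm_sq_sum_of_pairwise (pairwise_smul hE a)]
  simp only [norm_smul_sq]

/-- Pythagoras' identity in a space of Sobolev type, whose norm is `‖P x‖² + ∑ i, ‖D i x‖²`: each
"derivative" `D i` maps `E` to multiples of an orthogonal family. -/
lemma isPythagorean_of_norm_sq_eq {κ Y Z : Type*} [Fintype κ] [NormedAddCommGroup Y]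
    [NormedSpace ℝ Y] [NormedAddCommGroup Z] [NormedSpace ℝ Z] (P : X →L[ℝ] Y)
    (D : κ → X →L[ℝ] Z) (hnorm : ∀ x, ‖x‖ ^ 2 = ‖P x‖ ^ 2 + ∑ i, ‖D i x‖ ^ 2) {E : ι → X}
    {F : ι → Y} {v : ι → ℝ} (hF : IsPythagorean F v) (hP : ∀ k, P (E k) = F k) {c : κ → ι → ℝ}
    {G : ι → Z} {w : ι → ℝ} (hG : IsPythagorean G w) (hD : ∀ i k, D i (E k) = c i k • G k) :
    IsPythagorean E fun k => v k + (∑ i, c i k ^ 2) * w k := by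
  intro s a
  rw [hnorm]
  simp only [map_sum, map_smul, hP, hD, smul_smul]
  rw [hF s a, Finset.sum_congr rfl fun i _ => hG s fun k => a k * c i k, Finset.sum_comm,
    ← Finset.sum_add_distrib]
  refine Finset.sum_congr rfl fun k _ => ?_
  simp only [mul_pow, mul_assoc]
  rw [← Finset.mul_sum, ← Finset.sum_mul, ← mul_add]

namespace IsPythagorean

variable {E : ι → X} {w : ι → ℝ}

lemma norm_sq (hE : IsPythagorean E w) (k : ι) : ‖E k‖ ^ 2 = w k := by
  simpa using hE {k} 1

lemma comp_injective (hE : IsPythagorean E w) {κ : Type*} {e : κ → ι}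
    (he : Function.Injective e) : IsPythagorean (fun j => E (e j)) fun j => w (e j) := by
  intro s a
  rcases isEmpty_or_nonempty κ with _ | _
  · simp [Finset.eq_empty_of_isEmpty s]
  · have h := hE (s.map ⟨e, he⟩) fun k => a (Function.invFun e k)
    simpa [Function.leftInverse_invFun he _] using h

lemma smul (hE : IsPythagorean E w) (c : ι → ℝ) :
    IsPythagorean (fun k => c k • E k) fun k => c k ^ 2 * w k := by
  intro s a
  simp only [smul_smul]
  refine (hE s fun k => a k * c k).trans (Finset.sum_congr rfl fun k _ => ?_)
  ring

lemma nonneg (hE : IsPythagorean E w) (k : ι) : 0 ≤ w k := hE.norm_sq k ▸ sq_nonneg _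

lemma hasSum_norm_sq (hE : IsPythagorean E w) {a : ι → ℝ} {V : X}
    (h : HasSum (fun k => a k • E k) V) : HasSum (fun k => a k ^ 2 * w k) (‖V‖ ^ 2) := by
  have h1 : Tendsto (fun s : Finset ι => ‖∑ k ∈ s, a k • E k‖ ^ 2) atTop (𝓝 (‖V‖ ^ 2)) :=
    (Tendsto.norm h).pow 2
  simp only [hE _ a] at h1
  exact h1

lemma summable [CompleteSpace X] (hE : IsPythagorean E w) {a : ι → ℝ}
    (h : Summable fun k => a k ^ 2 * w k) : Summable fun k => a k • E k := by
  rw [summable_iff_vanishing_norm]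
  intro ε hε
  obtain ⟨s, hs⟩ := summable_iff_vanishing_norm.1 h (ε ^ 2) (by positivity)
  refine ⟨s, fun t ht => ?_⟩
  have := hs t ht
  rw [← hE t a, Real.norm_of_nonneg (by positivity)] at this
  exact lt_of_pow_lt_pow_left₀ 2 hε.le this

end IsPythagorean

/-- Uniform convergence of an orthogonal series whose terms are dominated uniformly in time. -/
lemma orthogonalSeries_continuousOn [CompleteSpace X] {E : ι → X}
    {w : ι → ℝ} (hE : IsPythagorean E w) {a : ι → ℝ → ℝ} {S : Set ℝ}
    (ha : ∀ k, Continuous (a k)) {M : ι → ℝ} (hM : Summable M)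
    (h : ∀ k, ∀ t ∈ S, a k t ^ 2 * w k ≤ M k) :
    ContinuousOn (fun t => ∑' k, a k t • E k) S ∧
      ∀ t ∈ S, HasSum (fun k => a k t • E k) (∑' k, a k t • E k) := by
  have hsq : ∀ t ∈ S, Summable fun k => a k t ^ 2 * w k := fun t ht =>
    Summable.of_nonneg_of_le (fun k => mul_nonneg (sq_nonneg _) (hE.nonneg k))
      (fun k => h k t ht) hM
  have hsum : ∀ t ∈ S, HasSum (fun k => a k t • E k) (∑' k, a k t • E k) := fun t ht =>
    (hE.summable (hsq t ht)).hasSum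
  refine ⟨?_, hsum⟩
  have hunif : TendstoUniformlyOn (fun (s : Finset ι) t => ∑ k ∈ s, a k t • E k)
      (fun t => ∑' k, a k t • E k) atTop S := by
    rw [Metric.tendstoUniformlyOn_iff]
    intro ε hε
    obtain ⟨s, hs⟩ := summable_iff_vanishing_norm.1 hM ((ε / 2) ^ 2) (by positivity)
    filter_upwards [eventually_ge_atTop s] with s' hs' t ht
    have hle : ∀ᶠ r in atTop, ‖∑ k ∈ r, a k t • E k - ∑ k ∈ s', a k t • E k‖ ≤ ε / 2 := by
      classical
      filter_upwards [eventually_ge_atTop s'] with r hr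
      rw [← Finset.sum_sdiff hr, add_sub_cancel_right]
      refine le_of_sq_le_sq ?_ (by positivity)
      rw [hE _ fun k => a k t]
      have hdis : Disjoint (r \ s') s := Finset.disjoint_of_subset_right hs' Finset.sdiff_disjoint
      calc ∑ k ∈ r \ s', a k t ^ 2 * w k ≤ ∑ k ∈ r \ s', M k :=
            Finset.sum_le_sum fun k _ => h k t ht
        _ ≤ ‖∑ k ∈ r \ s', M k‖ := Real.le_norm_self _
        _ ≤ (ε / 2) ^ 2 := (hs _ hdis).le
    have hlim : Tendsto (fun r : Finset ι => ‖∑ k ∈ r, a k t • E k - ∑ k ∈ s', a k t • E k‖) atTop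
        (𝓝 ‖∑' k, a k t • E k - ∑ k ∈ s', a k t • E k‖) :=
      ((hsum t ht).sub_const _).norm
    rw [dist_eq_norm]
    exact (le_of_tendsto hlim hle).trans_lt (by linarith)
  refine hunif.continuousOn (Frequently.of_forall fun s => ?_)
  exact Continuous.continuousOn (by fun_prop)

/-- Mean-square convergence of an orthogonal series whose terms are square-summable in time. -/
lemma orthogonalSeries_memL2Time [CompleteSpace X] [Countable ι] {T : ℝ} {E : ι → X}
    {w : ι → ℝ} (hE : IsPythagorean E w) {a : ι → ℝ → ℝ}
    (ha : ∀ k, Continuous (a k)) {M : ι → ℝ} (hM : Summable M)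
    (h : ∀ k, (∫ t in Icc 0 T, a k t ^ 2) * w k ≤ M k) :
    MemL2Time T (fun t => ∑' k, a k t • E k) ∧ ∀ᵐ t ∂volume.restrict (Icc 0 T),
      HasSum (fun k => a k t • E k) (∑' k, a k t • E k) := by
  set μ : Measure ℝ := volume.restrict (Icc 0 T) with hμ
  have hm : ∀ k, Measurable fun t => ENNReal.ofReal (a k t ^ 2 * w k) := fun k =>
    ENNReal.measurable_ofReal.comp (Continuous.measurable (by fun_prop))
  have hk : ∀ k, ∫⁻ t, ENNReal.ofReal (a k t ^ 2 * w k) ∂μ ≤ ENNReal.ofReal (M k) := by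
    intro k
    have hi : Integrable (fun t => a k t ^ 2 * w k) μ :=
      (Continuous.continuousOn (by fun_prop)).integrableOn_compact isCompact_Icc
    rw [← ofReal_integral_eq_lintegral_ofReal hi
      (Eventually.of_forall fun t => mul_nonneg (sq_nonneg _) (hE.nonneg k)),
      integral_mul_const]
    exact ENNReal.ofReal_le_ofReal (h k)
  have hfin : ∫⁻ t, ∑' k, ENNReal.ofReal (a k t ^ 2 * w k) ∂μ ≠ ⊤ := by
    rw [lintegral_tsum fun k => (hm k).aemeasurable]
    have h1 : ∑' k, ENNReal.ofReal (M k) ≠ ⊤ :=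
      hM.tsum_ofReal_ne_top
    exact ne_top_of_le_ne_top h1 (ENNReal.tsum_le_tsum hk)
  have hae : ∀ᵐ t ∂μ, HasSum (fun k => a k t • E k) (∑' k, a k t • E k) := by
    filter_upwards [ae_lt_top (Measurable.tsum hm) hfin] with t ht
    refine (hE.summable ?_).hasSum
    have h1 := ENNReal.summable_toReal ht.ne
    simpa only [ENNReal.toReal_ofReal (mul_nonneg (sq_nonneg _) (hE.nonneg _))] using h1
  refine ⟨?_, hae⟩
  have hmeas : AEStronglyMeasurable (fun t => ∑' k, a k t • E k) μ :=
    aestronglyMeasurable_of_tendsto_ae (atTop : Filter (Finset ι))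
      (f := fun s t => ∑ k ∈ s, a k t • E k)
      (fun s => Continuous.aestronglyMeasurable (by fun_prop)) hae
  refine (memLp_two_iff_integrable_sq_norm hmeas).2 ⟨(hmeas.norm.pow 2), ?_⟩
  rw [HasFiniteIntegral]
  refine lt_of_le_of_lt (lintegral_mono_ae ?_) (lt_top_iff_ne_top.2 hfin)
  filter_upwards [hae] with t ht
  have h1 := hE.hasSum_norm_sq ht
  rw [Real.enorm_of_nonneg (by positivity), ← h1.tsum_eq,
    ENNReal.ofReal_tsum_of_nonneg (fun k => mul_nonneg (sq_nonneg _) (hE.nonneg k))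
      h1.summable]

end Pythagorean

/-! ### Mild solutions of a diagonal evolution equation -/

section Mild

variable {ι H : Type*} [NormedAddCommGroup H] [InnerProductSpace ℝ H]

/-- The `k`-th coefficient of the mild solution of `u' + A u = g`, `u 0 = θ`, where `A` is
diagonal in the basis `b` with eigenvalues `lam`. -/
def mildCoeff (b : HilbertBasis ι ℝ H) (lam : ι → ℝ) (θ : H) (g : ℝ → H) (k : ι) : ℝ → ℝ :=
  duhamel (lam k) (inner ℝ (b k) θ) fun s => inner ℝ (b k) (g s)

/-- The mild solution of `u' + A u = g`, `u 0 = θ`, where `A` is diagonal in the basis `b` with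
eigenvalues `lam`. -/
def mild (b : HilbertBasis ι ℝ H) (lam : ι → ℝ) (θ : H) (g : ℝ → H) (t : ℝ) : H :=
  ∑' k, mildCoeff b lam θ g k t • b k

variable (b : HilbertBasis ι ℝ H) {lam : ι → ℝ} {θ : H} {g : ℝ → H}

lemma isPythagorean_basis : IsPythagorean b fun _ => 1 := by
  simpa [b.orthonormal.1] using isPythagorean_of_pairwise b.orthonormal.2

lemma ext_basis {x y : H} (h : ∀ k, inner ℝ (b k) x = inner ℝ (b k) y) : x = y := by
  refine b.repr.injective ?_
  ext k
  simpa only [HilbertBasis.repr_apply_apply] using h k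

lemma mildCoeff_continuous (hg : Continuous g) (k : ι) : Continuous (mildCoeff b lam θ g k) :=
  duhamel_continuous _ _ (by fun_prop)

lemma mildCoeff_hasDerivAt (hg : Continuous g) (k : ι) (t : ℝ) :
    HasDerivAt (mildCoeff b lam θ g k)
      (-lam k * mildCoeff b lam θ g k t + inner ℝ (b k) (g t)) t :=
  duhamel_hasDerivAt _ _ (by fun_prop) t

lemma sum_integral_inner_sq_le (hg : Continuous g) {T : ℝ} (hT : 0 ≤ T) (s : Finset ι) :
    ∑ k ∈ s, ∫ t in (0 : ℝ)..T, inner ℝ (b k) (g t) ^ 2 ≤ ∫ t in (0 : ℝ)..T, ‖g t‖ ^ 2 := by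
  rw [← intervalIntegral.integral_finsetSum
    fun k _ => Continuous.intervalIntegrable (by fun_prop) _ _]
  refine intervalIntegral.integral_mono_on hT (Continuous.intervalIntegrable (by fun_prop) _ _)
    (Continuous.intervalIntegrable (by fun_prop) _ _) fun t _ => ?_
  simpa only [Real.norm_eq_abs, sq_abs] using b.orthonormal.sum_inner_products_le (g t) (s := s)

lemma summable_integral_inner_sq (hg : Continuous g) {T : ℝ} (hT : 0 ≤ T) :
    Summable fun k => ∫ t in (0 : ℝ)..T, inner ℝ (b k) (g t) ^ 2 :=
  summable_of_sum_le (fun _ => intervalIntegral.integral_nonneg hT fun _ _ => sq_nonneg _)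
    (sum_integral_inner_sq_le b hg hT)

lemma summable_inner_sq : Summable fun k => inner ℝ (b k) θ ^ 2 := by
  simpa only [Real.norm_eq_abs, sq_abs] using b.orthonormal.inner_products_summable θ

lemma integral_sq_mono {q : ℝ → ℝ} (hq : Continuous q) {t T : ℝ} (ht : t ∈ Icc 0 T) :
    ∫ s in (0 : ℝ)..t, q s ^ 2 ≤ ∫ s in (0 : ℝ)..T, q s ^ 2 :=
  intervalIntegral.integral_mono_interval le_rfl ht.1 ht.2
    (Eventually.of_forall fun s => sq_nonneg _) (Continuous.intervalIntegrable (by fun_prop) _ _)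

lemma mildCoeff_sq_le (hlam : ∀ k, 0 ≤ lam k) (hg : Continuous g) {T t : ℝ} (ht : t ∈ Icc 0 T)
    (k : ι) : mildCoeff b lam θ g k t ^ 2 ≤
      Real.exp T * (inner ℝ (b k) θ ^ 2 + ∫ s in (0 : ℝ)..T, inner ℝ (b k) (g s) ^ 2) := by
  have hq : Continuous fun s => inner ℝ (b k) (g s) := by fun_prop
  refine (duhamel_sq_le (hlam k) _ hq ht.1).trans ?_
  have h1 : 0 ≤ ∫ s in (0 : ℝ)..t, inner ℝ (b k) (g s) ^ 2 :=
    intervalIntegral.integral_nonneg ht.1 fun _ _ => sq_nonneg _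
  have h2 := integral_sq_mono hq ht
  have h3 := ht.2
  gcongr

/-- With initial value in the form domain, the mild solution is continuous in the form domain:
`E k` stands for the basis vector `b k` seen in a space in which its squared norm `w k` is at most
`1 + lam k`. -/
lemma mild_continuousOn (hlam : ∀ k, 0 ≤ lam k)
    (hθ : Summable fun k => lam k * inner ℝ (b k) θ ^ 2) (hg : Continuous g) {T : ℝ} (hT : 0 ≤ T)
    {X : Type*} [NormedAddCommGroup X] [NormedSpace ℝ X] [CompleteSpace X] {E : ι → X} {w : ι → ℝ}
    (hE : IsPythagorean E w) (hEn : ∀ k, w k ≤ 1 + lam k) :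
    ContinuousOn (fun t => ∑' k, mildCoeff b lam θ g k t • E k) (Icc 0 T) ∧
      ∀ t ∈ Icc 0 T, HasSum (fun k => mildCoeff b lam θ g k t • E k)
        (∑' k, mildCoeff b lam θ g k t • E k) := by
  have hsq := summable_integral_inner_sq b hg hT
  refine orthogonalSeries_continuousOn hE (mildCoeff_continuous b hg)
    ((((summable_inner_sq b (θ := θ)).add hsq).mul_left (Real.exp T)).add (hθ.add hsq))
    fun k t ht => ?_
  have hq : Continuous fun s => inner ℝ (b k) (g s) := by fun_prop
  have h1 := mildCoeff_sq_le b (θ := θ) hlam hg ht k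
  have h2 := duhamel_energy (lam k) (inner ℝ (b k) θ) hq ht.1
  have h3 := integral_sq_mono hq ht
  have h4 : 0 ≤ ∫ s in (0 : ℝ)..t, duhamel (lam k) (inner ℝ (b k) θ)
      (fun s => inner ℝ (b k) (g s)) s ^ 2 :=
    intervalIntegral.integral_nonneg ht.1 fun _ _ => sq_nonneg _
  have h5 : mildCoeff b lam θ g k t ^ 2 * w k ≤
      mildCoeff b lam θ g k t ^ 2 * (1 + lam k) := by
    gcongr
    exact hEn k
  refine h5.trans ?_
  have h6 := mul_nonneg (sq_nonneg (lam k)) h4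
  unfold mildCoeff at *
  linarith

/-- Maximal regularity: `E k` stands for the basis vector `b k`, or a derivative of it, seen in a
space in which its squared norm `w k` is of order `1 + (lam k)²`. -/
lemma mild_memL2Time [Countable ι] (hlam : ∀ k, 0 ≤ lam k)
    (hθ : Summable fun k => lam k * inner ℝ (b k) θ ^ 2) (hg : Continuous g) {T : ℝ} (hT : 0 ≤ T)
    {X : Type*} [NormedAddCommGroup X] [NormedSpace ℝ X] [CompleteSpace X] {E : ι → X} {w : ι → ℝ}
    (hE : IsPythagorean E w) (hEn : ∀ k, w k ≤ 2 * (1 + lam k ^ 2)) :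
    MemL2Time T (fun t => ∑' k, mildCoeff b lam θ g k t • E k) ∧
      ∀ᵐ t ∂volume.restrict (Icc 0 T), HasSum (fun k => mildCoeff b lam θ g k t • E k)
        (∑' k, mildCoeff b lam θ g k t • E k) := by
  have hsq := summable_integral_inner_sq b hg hT
  refine orthogonalSeries_memL2Time hE (mildCoeff_continuous b hg)
    (((((summable_inner_sq b (θ := θ)).add hsq).mul_left (Real.exp T)).mul_left T).add
      (hθ.add hsq) |>.mul_left 2)
    fun k => ?_
  have hq : Continuous fun s => inner ℝ (b k) (g s) := by fun_prop
  have hc := mildCoeff_continuous b (lam := lam) (θ := θ) hg k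
  rw [integral_Icc_eq hT]
  set I := ∫ t in (0 : ℝ)..T, mildCoeff b lam θ g k t ^ 2 with hI
  have hI0 : 0 ≤ I := intervalIntegral.integral_nonneg hT fun _ _ => sq_nonneg _
  have h1 : I ≤ T * (Real.exp T * (inner ℝ (b k) θ ^ 2 +
      ∫ s in (0 : ℝ)..T, inner ℝ (b k) (g s) ^ 2)) := by
    have := intervalIntegral.integral_mono_on (μ := volume) hT
      (Continuous.intervalIntegrable (hc.pow 2) _ _)
      (Continuous.intervalIntegrable continuous_const _ _)
      fun t ht => mildCoeff_sq_le b (θ := θ) hlam hg ht k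
    rwa [intervalIntegral.integral_const, sub_zero, smul_eq_mul] at this
  have h2 := duhamel_energy (lam k) (inner ℝ (b k) θ) hq hT
  have h3 : I * w k ≤ I * (2 * (1 + lam k ^ 2)) := by
    gcongr
    exact hEn k
  have h4 : 0 ≤ lam k * mildCoeff b lam θ g k T ^ 2 := mul_nonneg (hlam k) (sq_nonneg _)
  refine h3.trans ?_
  change lam k * mildCoeff b lam θ g k T ^ 2 + lam k ^ 2 * I ≤ _ at h2
  linarith

/-- The time derivative of the mild solution is square integrable. -/
lemma mild_deriv_memL2Time [CompleteSpace H] [Countable ι] (hlam : ∀ k, 0 ≤ lam k)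
    (hθ : Summable fun k => lam k * inner ℝ (b k) θ ^ 2) (hg : Continuous g) {T : ℝ}
    (hT : 0 ≤ T) :
    MemL2Time T (fun t => ∑' k,
        (-lam k * mildCoeff b lam θ g k t + inner ℝ (b k) (g t)) • b k) ∧
      ∀ᵐ t ∂volume.restrict (Icc 0 T),
        HasSum (fun k => (-lam k * mildCoeff b lam θ g k t + inner ℝ (b k) (g t)) • b k)
        (∑' k, (-lam k * mildCoeff b lam θ g k t + inner ℝ (b k) (g t)) • b k) := by
  have hsq := summable_integral_inner_sq b hg hT
  have hc := fun k => mildCoeff_continuous b (lam := lam) (θ := θ) hg k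
  refine orthogonalSeries_memL2Time
    (a := fun k t => -lam k * mildCoeff b lam θ g k t + inner ℝ (b k) (g t))
    (isPythagorean_basis b) (fun k => by have := hc k; fun_prop)
    ((hθ.mul_left 2).add (hsq.mul_left 4)) fun k => ?_
  have hq : Continuous fun s => inner ℝ (b k) (g s) := by fun_prop
  rw [integral_Icc_eq hT, mul_one]
  exact integral_deriv_duhamel_sq_le (hlam k) _ hq hT

lemma inner_of_hasSum {a : ι → ℝ} {x : H} (h : HasSum (fun k => a k • b k) x) (k : ι) :
    inner ℝ (b k) x = a k := by
  classical
  have h1 := (innerSL ℝ (b k)).hasSum h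
  simp only [innerSL_apply_apply, inner_smul_right,
    orthonormal_iff_ite.1 b.orthonormal] at h1
  have h2 : HasSum (fun j => a j * if k = j then (1 : ℝ) else 0) (a k) := by
    convert hasSum_ite_eq k (a k) using 2 with j
    by_cases h : k = j
    · simp [h]
    · simp [h, Ne.symm h]
  exact h1.unique h2

lemma isWeakTimeDeriv_mild [CompleteSpace H] [Countable ι] (hlam : ∀ k, 0 ≤ lam k)
    (hθ : Summable fun k => lam k * inner ℝ (b k) θ ^ 2) (hg : Continuous g) {T : ℝ}
    (hT : 0 ≤ T) {u : ℝ → H} (hu : ContinuousOn u (Icc 0 T))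
    (huc : ∀ k, ∀ t ∈ Icc 0 T, inner ℝ (b k) (u t) = mildCoeff b lam θ g k t) :
    IsWeakTimeDeriv T u
      (fun t => ∑' k, (-lam k * mildCoeff b lam θ g k t + inner ℝ (b k) (g t)) • b k) := by
  obtain ⟨hw, hws⟩ := mild_deriv_memL2Time b hlam hθ hg hT
  have hu' : IntegrableOn u (Icc 0 T) := hu.integrableOn_compact isCompact_Icc
  have hw' : IntegrableOn (fun t => ∑' k,
      (-lam k * mildCoeff b lam θ g k t + inner ℝ (b k) (g t)) • b k) (Icc 0 T) :=
    MemLp.integrable (by norm_num) hw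
  refine ⟨hu', hw', fun φ hφ hc hs => ?_⟩
  have hbd : ∀ ψ : ℝ → ℝ, Continuous ψ → ∀ v : ℝ → H, IntegrableOn v (Icc 0 T) →
      IntegrableOn (fun t => ψ t • v t) (Icc 0 T) := fun ψ hψ v hv =>
    hv.continuousOn_smul hψ.continuousOn isCompact_Icc
  refine ext_basis b fun k => ?_
  rw [inner_neg_right, ← integral_inner (hbd _ (hφ.continuous_deriv (by simp)) u hu'),
    ← integral_inner (hbd _ hφ.continuous _ hw')]
  simp only [inner_smul_right]
  have hcont := mildCoeff_continuous b (lam := lam) (θ := θ) hg k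
  rw [setIntegral_congr_fun (g := fun t => deriv φ t * mildCoeff b lam θ g k t) measurableSet_Icc
    fun t ht => by simp only [huc k t ht],
    integral_deriv_mul_eq_neg hT hφ hs (fun t => mildCoeff_hasDerivAt b hg k t)
      (by fun_prop)]
  congr 1
  refine integral_congr_ae ?_
  filter_upwards [hws] with t ht
  rw [inner_of_hasSum b ht k]

/-- Lipschitz dependence of the mild solution on the right-hand side, in Volterra form. -/
lemma norm_mild_sub_sq_le [CompleteSpace H] (hlam : ∀ k, 0 ≤ lam k)
    (hθ : Summable fun k => lam k * inner ℝ (b k) θ ^ 2) {g₁ g₂ : ℝ → H} (hg₁ : Continuous g₁)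
    (hg₂ : Continuous g₂) {T t : ℝ} (ht : t ∈ Icc 0 T) :
    ‖mild b lam θ g₁ t - mild b lam θ g₂ t‖ ^ 2 ≤
      Real.exp T * ∫ s in (0 : ℝ)..t, ‖g₁ s - g₂ s‖ ^ 2 := by
  have hT := ht.1.trans ht.2
  have hb : ∀ k, 1 ≤ 1 + lam k := fun k => by linarith [hlam k]
  have h1 := (mild_continuousOn b hlam hθ hg₁ hT (isPythagorean_basis b) hb).2 t ht
  have h2 := (mild_continuousOn b hlam hθ hg₂ hT (isPythagorean_basis b) hb).2 t ht
  have h3 := h1.sub h2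
  simp only [← sub_smul] at h3
  have h4 := (isPythagorean_basis b).hasSum_norm_sq h3
  have he : Real.exp t ≤ Real.exp T := Real.exp_le_exp.2 ht.2
  refine hasSum_le_of_sum_le h4 fun s => ?_
  calc ∑ k ∈ s, (mildCoeff b lam θ g₁ k t - mildCoeff b lam θ g₂ k t) ^ 2 * 1
      ≤ ∑ k ∈ s, Real.exp T * ∫ r in (0 : ℝ)..t, inner ℝ (b k) (g₁ r - g₂ r) ^ 2 := by
        refine Finset.sum_le_sum fun k _ => ?_
        have hq₁ : Continuous fun s => inner ℝ (b k) (g₁ s) := by fun_prop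
        have hq₂ : Continuous fun s => inner ℝ (b k) (g₂ s) := by fun_prop
        rw [mul_one]
        unfold mildCoeff
        rw [duhamel_sub _ _ hq₁ hq₂]
        refine (duhamel_sq_le (hlam k) 0 (by fun_prop) ht.1).trans ?_
        simp only [inner_sub_right, ne_eq, OfNat.ofNat_ne_zero, not_false_eq_true, zero_pow,
          zero_add]
        refine mul_le_mul_of_nonneg_right he ?_
        exact intervalIntegral.integral_nonneg ht.1 fun _ _ => sq_nonneg _
    _ = Real.exp T * ∑ k ∈ s, ∫ r in (0 : ℝ)..t, inner ℝ (b k) (g₁ r - g₂ r) ^ 2 := by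
        rw [Finset.mul_sum]
    _ ≤ _ := by
        gcongr
        exact sum_integral_inner_sq_le b (hg₁.sub hg₂) ht.1 s

end Mild

/-! ### The semilinear equation -/

section Picard

variable {ι H : Type*} [NormedAddCommGroup H] [InnerProductSpace ℝ H] [CompleteSpace H]

open scoped NNReal Nat

/-- For Lipschitz `F` the Picard map `u ↦ mild solution with right-hand side F(u)` has exactly one
fixed point, because the squared distance of its `n`-th iterates is `O((C T)ⁿ / n!)`. Curves on
`[0,T]` are extended to `ℝ` by constants. -/
lemma existsUnique_mild (b : HilbertBasis ι ℝ H) {lam : ι → ℝ} (hlam : ∀ k, 0 ≤ lam k) {θ : H}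
    (hθ : Summable fun k => lam k * inner ℝ (b k) θ ^ 2) {F : H → H} {K : ℝ≥0}
    (hF : LipschitzWith K F) {T : ℝ} (hT : 0 ≤ T) :
    ∃! u : C(Icc (0 : ℝ) T, H), ∀ t : Icc (0 : ℝ) T,
      u t = mild b lam θ (fun s => F (IccExtend hT u s)) t := by
  have hcont : ∀ u : C(Icc (0 : ℝ) T, H), Continuous fun s => F (IccExtend hT u s) := fun u =>
    hF.continuous.comp u.continuous.Icc_extend'
  have hb : ∀ k, 1 ≤ 1 + lam k := fun k => by linarith [hlam k]
  let Φ : C(Icc (0 : ℝ) T, H) → C(Icc (0 : ℝ) T, H) := fun u =>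
    ⟨fun t => mild b lam θ (fun s => F (IccExtend hT u s)) t,
      continuousOn_iff_continuous_domRestrict.1
        (mild_continuousOn b hlam hθ (hcont u) hT (isPythagorean_basis b) hb).1⟩
  set C : ℝ := Real.exp T * K ^ 2 with hC
  have hC0 : 0 ≤ C := by positivity
  have hiter : ∀ (u v : C(Icc (0 : ℝ) T, H)) (n : ℕ) (t : Icc (0 : ℝ) T),
      ‖Φ^[n] u t - Φ^[n] v t‖ ^ 2 ≤ (C * t) ^ n / n ! * dist u v ^ 2 := by
    intro u v n
    induction n with
    | zero =>
      intro t
      have h1 := ContinuousMap.dist_apply_le_dist (f := u) (g := v) t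
      rw [dist_eq_norm] at h1
      simpa using pow_le_pow_left₀ (norm_nonneg _) h1 2
    | succ n ih =>
      intro t
      rw [Function.iterate_succ_apply', Function.iterate_succ_apply']
      set u' := Φ^[n] u
      set v' := Φ^[n] v
      refine (norm_mild_sub_sq_le b hlam hθ (hcont u') (hcont v') t.2).trans ?_
      have h1 : ∫ s in (0 : ℝ)..t, ‖F (IccExtend hT u' s) - F (IccExtend hT v' s)‖ ^ 2 ≤
          ∫ s in (0 : ℝ)..t, (K : ℝ) ^ 2 * C ^ n / n ! * dist u v ^ 2 * s ^ n := by
        refine intervalIntegral.integral_mono_on t.2.1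
          (Continuous.intervalIntegrable
            (((hcont u').sub (hcont v')).norm.pow 2) _ _)
          (Continuous.intervalIntegrable (by fun_prop) _ _) fun s hs => ?_
        have hs' : s ∈ Icc (0 : ℝ) T := ⟨hs.1, hs.2.trans t.2.2⟩
        rw [IccExtend_of_mem hT _ hs', IccExtend_of_mem hT _ hs']
        have h2 := hF.norm_sub_le (u' ⟨s, hs'⟩) (v' ⟨s, hs'⟩)
        calc ‖F (u' ⟨s, hs'⟩) - F (v' ⟨s, hs'⟩)‖ ^ 2
            ≤ (K * ‖u' ⟨s, hs'⟩ - v' ⟨s, hs'⟩‖) ^ 2 := by gcongr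
          _ = K ^ 2 * ‖u' ⟨s, hs'⟩ - v' ⟨s, hs'⟩‖ ^ 2 := by ring
          _ ≤ K ^ 2 * ((C * s) ^ n / n ! * dist u v ^ 2) := by gcongr; exact ih ⟨s, hs'⟩
          _ = _ := by ring
      calc Real.exp T * ∫ s in (0 : ℝ)..t, ‖F (IccExtend hT u' s) - F (IccExtend hT v' s)‖ ^ 2
          ≤ Real.exp T *
            ∫ s in (0 : ℝ)..t, (K : ℝ) ^ 2 * C ^ n / n ! * dist u v ^ 2 * s ^ n := by gcongr
        _ = _ := by
          rw [intervalIntegral.integral_const_mul, integral_pow, Nat.factorial_succ]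
          have h3 : (n ! : ℝ) ≠ 0 := by positivity
          have h4 : (n : ℝ) + 1 ≠ 0 := by positivity
          rw [hC]
          push_cast
          field_simp
          ring
  obtain ⟨n, hn⟩ := (FloorSemiring.tendsto_pow_div_factorial_atTop (C * T)
    |>.eventually (gt_mem_nhds (show (0 : ℝ) < (1 / 2) ^ 2 by norm_num))).exists
  have hcontr : ContractingWith (1 / 2 : ℝ≥0) Φ^[n] := by
    refine ⟨by rw [← NNReal.coe_lt_coe]; norm_num, LipschitzWith.of_dist_le_mul fun u v => ?_⟩
    rw [ContinuousMap.dist_le (by positivity)]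
    intro t
    rw [dist_eq_norm]
    refine le_of_sq_le_sq ?_ (by positivity)
    refine (hiter u v n t).trans ?_
    have h1 : (C * t) ^ n / n ! ≤ (C * T) ^ n / n ! := by
      have := t.2.1
      have := t.2.2
      gcongr
    rw [mul_pow _ (dist u v)]
    refine mul_le_mul_of_nonneg_right ?_ (sq_nonneg (dist u v))
    exact h1.trans (hn.le.trans_eq (by norm_num))
  refine ⟨hcontr.fixedPoint _, fun t => ?_, fun v hv => ?_⟩
  · exact (DFunLike.congr_fun hcontr.isFixedPt_fixedPoint_iterate t).symm
  · have : Function.IsFixedPt Φ v := by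
      ext t
      exact (hv t).symm
    exact hcontr.fixedPoint_unique (this.iterate n)

end Picard

/-! ### Integration by parts on the torus -/

section Torus

variable {d : ℕ}

lemma toTorus_add_single (y : Fin d → ℝ) (i : Fin d) (s : ℝ) :
    toTorus y + Pi.single i (s : UnitAddCircle) = toTorus (y + s • Pi.single i 1) := by
  funext j
  by_cases hj : j = i
  · subst hj; simp [toTorus]
  · simp [toTorus, Pi.single_eq_of_ne hj]

lemma IsSmooth.hasDerivAt_single {φ : UnitAddTorus (Fin d) → ℝ} (hφ : IsSmooth φ) (i : Fin d)
    (x : UnitAddTorus (Fin d)) (s : ℝ) :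
    HasDerivAt (fun s : ℝ => φ (x + Pi.single i (s : UnitAddCircle)))
      (ReactionDiffusion.pderiv i φ (x + Pi.single i (s : UnitAddCircle))) s := by
  obtain ⟨y, rfl⟩ := (isOpenQuotientMap_toTorus d).surjective x
  simp only [toTorus_add_single]
  rw [hφ.pderiv_toTorus]
  have hd : HasFDerivAt (fun y : Fin d → ℝ => φ (toTorus y))
      (fderiv ℝ (fun y : Fin d → ℝ => φ (toTorus y)) (y + s • Pi.single i 1))
      (y + s • Pi.single i 1) :=
    ((hφ.differentiable (by simp)).differentiableAt).hasFDerivAt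
  have hl : HasDerivAt (fun s : ℝ => y + s • (Pi.single i 1 : Fin d → ℝ)) (Pi.single i 1) s := by
    simpa using ((hasDerivAt_id s).smul_const (Pi.single i 1 : Fin d → ℝ)).const_add y
  exact hd.comp_hasDerivAt s hl

lemma IsSmooth.hasDerivAt_zero {φ : UnitAddTorus (Fin d) → ℝ} (hφ : IsSmooth φ) (i : Fin d)
    (x : UnitAddTorus (Fin d)) :
    HasDerivAt (fun s : ℝ => φ (x + Pi.single i (s : UnitAddCircle)))
      (ReactionDiffusion.pderiv i φ x) 0 := by
  simpa using hφ.hasDerivAt_single i x 0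

lemma integrable_torus {φ : UnitAddTorus (Fin d) → ℝ} (hφ : Continuous φ) :
    Integrable φ (torusMeasure d) :=
  hφ.integrable_of_hasCompactSupport (HasCompactSupport.of_compactSpace φ)

/-- By translation invariance, the integral of a derivative over the torus vanishes. -/
lemma integral_pderiv_eq_zero {φ : UnitAddTorus (Fin d) → ℝ} (hφ : IsSmooth φ) (i : Fin d) :
    ∫ x, pderiv i φ x ∂torusMeasure d = 0 := by
  have hc := (hφ.pderiv i).continuous
  obtain ⟨C, hC⟩ := isCompact_univ.exists_bound_of_continuousOn hc.continuousOn
  have hφc := hφ.continuous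
  have h := (hasDerivAt_integral_of_dominated_loc_of_deriv_le (μ := torusMeasure d)
    (F := fun (s : ℝ) x => φ (x + Pi.single i (s : UnitAddCircle)))
    (F' := fun (s : ℝ) x => pderiv i φ (x + Pi.single i (s : UnitAddCircle))) (x₀ := 0)
    (bound := fun _ => C) univ_mem
    (Eventually.of_forall fun s => Continuous.aestronglyMeasurable (by fun_prop))
    (integrable_torus (by fun_prop)) (Continuous.aestronglyMeasurable (by fun_prop))
    (Eventually.of_forall fun x s _ => hC _ (mem_univ _)) (integrable_const C)
    (Eventually.of_forall fun x s _ => hφ.hasDerivAt_single i x s)).2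
  have hconst : ∀ s : ℝ, ∫ x, φ (x + Pi.single i (s : UnitAddCircle)) ∂torusMeasure d =
      ∫ x, φ x ∂torusMeasure d := fun s => integral_add_right_eq_self φ _
  simp only [hconst] at h
  simpa using h.unique (hasDerivAt_const _ _)

lemma integral_mul_pderiv {φ ψ : UnitAddTorus (Fin d) → ℝ} (hφ : IsSmooth φ) (hψ : IsSmooth ψ)
    (i : Fin d) : ∫ x, φ x * pderiv i ψ x ∂torusMeasure d =
      -∫ x, pderiv i φ x * ψ x ∂torusMeasure d := by
  have hmul : IsSmooth fun x => φ x * ψ x := ContDiff.mul hφ hψ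
  have h := integral_pderiv_eq_zero hmul i
  have hp : ∀ x, pderiv i (fun x => φ x * ψ x) x = pderiv i φ x * ψ x + φ x * pderiv i ψ x :=
    fun x => by
      have h1 := (hφ.hasDerivAt_zero i x).mul (hψ.hasDerivAt_zero i x)
      simpa using (hmul.hasDerivAt_zero i x).unique h1
  have c1 := hφ.continuous
  have c2 := hψ.continuous
  have c3 := (hφ.pderiv i).continuous
  have c4 := (hψ.pderiv i).continuous
  simp only [hp] at h
  rw [integral_add (integrable_torus (by fun_prop)) (integrable_torus (by fun_prop))] at h
  linarith

/-- A continuous function on the torus as an element of `L²`. -/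
abbrev contL2 (φ : C(UnitAddTorus (Fin d), ℝ)) : L2 d :=
  ContinuousMap.toLp 2 (torusMeasure d) ℝ φ

lemma coeFn_contL2 (φ : C(UnitAddTorus (Fin d), ℝ)) : contL2 φ =ᵐ[torusMeasure d] φ :=
  ContinuousMap.coeFn_toLp _ φ

lemma inner_contL2 (φ : C(UnitAddTorus (Fin d), ℝ)) (u : L2 d) :
    inner ℝ (contL2 φ) u = ∫ x, u x * φ x ∂torusMeasure d := by
  rw [L2.inner_def]
  refine integral_congr_ae ?_
  filter_upwards [coeFn_contL2 φ] with x hx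
  rw [hx]
  rfl

lemma isWeakPartial_contL2 {φ ψ : C(UnitAddTorus (Fin d), ℝ)} (hφ : IsSmooth φ) {i : Fin d}
    (h : ∀ x, pderiv i φ x = ψ x) : IsWeakPartial i (contL2 φ) (contL2 ψ) := by
  intro χ hχ
  have h1 : ∫ x, contL2 φ x * pderiv i χ x ∂torusMeasure d =
      ∫ x, φ x * pderiv i χ x ∂torusMeasure d := by
    refine integral_congr_ae ?_
    filter_upwards [coeFn_contL2 φ] with x hx
    rw [hx]
  have h2 : ∫ x, contL2 ψ x * χ x ∂torusMeasure d = ∫ x, pderiv i φ x * χ x ∂torusMeasure d := by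
    refine integral_congr_ae ?_
    filter_upwards [coeFn_contL2 ψ] with x hx
    rw [hx, h]
  rw [h1, h2, integral_mul_pderiv hφ hχ]

lemma isWeakPartial_iff_inner {i : Fin d} {u g : L2 d} :
    IsWeakPartial i u g ↔ ∀ (φ : UnitAddTorus (Fin d) → ℝ) (hφ : IsSmooth φ),
      inner ℝ (contL2 ⟨_, (hφ.pderiv i).continuous⟩) u =
        -inner ℝ (contL2 ⟨φ, hφ.continuous⟩) g := by
  simp only [inner_contL2]
  rfl

/-! ### The Hartley basis -/

open UnitAddTorus in
/-- The Hartley function `x ↦ cos (2π n⋅x) + sin (2π n⋅x)`. These are real eigenfunctions of the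
Laplacian indexed by the whole lattice, and `∂_i` maps the `n`-th one to a multiple of the
`(-n)`-th. -/
def hartley (n : Fin d → ℤ) : C(UnitAddTorus (Fin d), ℝ) where
  toFun x := (mFourier n x).re + (mFourier n x).im
  continuous_toFun := by fun_prop

open UnitAddTorus in
lemma mFourier_toTorus (n : Fin d → ℤ) (y : Fin d → ℝ) :
    mFourier n (toTorus y) = Complex.exp ((2 * Real.pi * ∑ j, n j * y j : ℝ) * Complex.I) := by
  simp only [mFourier, toTorus, ContinuousMap.coe_mk, fourier_coe_apply]
  rw [← Complex.exp_sum]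
  congr 1
  push_cast
  rw [Finset.mul_sum, Finset.sum_mul]
  refine Finset.sum_congr rfl fun j _ => ?_
  ring

lemma hartley_toTorus (n : Fin d → ℤ) (y : Fin d → ℝ) :
    hartley n (toTorus y) =
      Real.cos (2 * Real.pi * ∑ j, n j * y j) + Real.sin (2 * Real.pi * ∑ j, n j * y j) := by
  simp only [hartley, ContinuousMap.coe_mk, mFourier_toTorus, Complex.exp_ofReal_mul_I_re,
    Complex.exp_ofReal_mul_I_im]

lemma hartley_isSmooth (n : Fin d → ℤ) : IsSmooth (hartley n) := by
  unfold IsSmooth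
  simp only [hartley_toTorus]
  fun_prop

lemma pderiv_hartley (n : Fin d → ℤ) (i : Fin d) (x : UnitAddTorus (Fin d)) :
    pderiv i (hartley n) x = ((2 * Real.pi * n i) • hartley (-n)) x := by
  obtain ⟨y, rfl⟩ := (isOpenQuotientMap_toTorus d).surjective x
  refine ((hartley_isSmooth n).hasDerivAt_zero i _).unique ?_
  have hs : ∀ s : ℝ, 2 * Real.pi * ∑ j, n j * (y + s • (Pi.single i 1 : Fin d → ℝ)) j =
      2 * Real.pi * ∑ j, n j * y j + s * (2 * Real.pi * n i) := fun s => by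
    simp only [Pi.add_apply, Pi.smul_apply, smul_eq_mul, mul_add, Finset.sum_add_distrib]
    have hi : ∑ j, (n j : ℝ) * (s * (Pi.single i 1 : Fin d → ℝ) j) = n i * s := by
      rw [Finset.sum_eq_single i (fun j _ hj => by simp [Pi.single_eq_of_ne hj]) (by simp)]
      simp
    rw [hi]
    ring
  simp only [toTorus_add_single, hartley_toTorus, hs, ContinuousMap.smul_apply, smul_eq_mul]
  have hl : HasDerivAt (fun s : ℝ => 2 * Real.pi * ∑ j, n j * y j + s * (2 * Real.pi * n i))
      (2 * Real.pi * n i) 0 := by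
    simpa using ((hasDerivAt_id (0 : ℝ)).mul_const (2 * Real.pi * n i)).const_add
      (2 * Real.pi * ∑ j, n j * y j)
  refine (hl.cos.add hl.sin).congr_deriv ?_
  simp only [zero_mul, add_zero, Pi.neg_apply, Int.cast_neg, neg_mul, Finset.sum_neg_distrib,
    mul_neg, Real.cos_neg, Real.sin_neg]
  ring

open UnitAddTorus in
lemma integral_mFourier (n : Fin d → ℤ) :
    ∫ x, mFourier n x ∂torusMeasure d = if n = 0 then 1 else 0 := by
  have h := orthonormal_iff_ite.1 (orthonormal_mFourier (d := Fin d)) 0 n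
  rw [ContinuousMap.inner_toLp] at h
  simp only [mFourier_zero, ContinuousMap.one_apply, map_one, mul_one,
    eq_comm (a := (0 : Fin d → ℤ))] at h
  exact h

/-- The Hartley functions in `L²`. -/
abbrev hartleyL2 (n : Fin d → ℤ) : L2 d := contL2 (hartley n)

open UnitAddTorus in
lemma hartley_mul (m n : Fin d → ℤ) (x : UnitAddTorus (Fin d)) :
    hartley n x * hartley m x = (mFourier (n - m) x).re + (mFourier (n + m) x).im := by
  rw [sub_eq_add_neg, mFourier_add, mFourier_add, mFourier_neg]
  simp only [hartley, ContinuousMap.coe_mk, Complex.mul_re, Complex.mul_im, Complex.conj_re,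
    Complex.conj_im]
  ring

open UnitAddTorus in
lemma orthonormal_hartleyL2 : Orthonormal ℝ (hartleyL2 (d := d)) := by
  have hint : ∀ n : Fin d → ℤ, Integrable (fun x => mFourier n x) (torusMeasure d) := fun n =>
    (map_continuous _).integrable_of_hasCompactSupport (HasCompactSupport.of_compactSpace _)
  have hre : ∀ n : Fin d → ℤ, ∫ x, (mFourier n x).re ∂torusMeasure d =
      if n = 0 then 1 else 0 := fun n => by
    have := integral_re (hint n)
    rw [integral_mFourier] at this
    refine this.trans ?_
    split_ifs <;> simp
  have him : ∀ n : Fin d → ℤ, ∫ x, (mFourier n x).im ∂torusMeasure d = 0 := fun n => by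
    have := integral_im (hint n)
    rw [integral_mFourier] at this
    refine this.trans ?_
    split_ifs <;> simp
  rw [orthonormal_iff_ite]
  intro m n
  rw [ContinuousMap.inner_toLp]
  simp only [conj_trivial, hartley_mul]
  refine (integral_add (hint (n - m)).re (hint (n + m)).im).trans ?_
  refine (congrArg₂ (· + ·) (hre _) (him _)).trans ?_
  simp only [add_zero, sub_eq_zero, eq_comm (a := n)]

open UnitAddTorus in
lemma span_hartleyL2_orthogonal :
    (Submodule.span ℝ (Set.range (hartleyL2 (d := d))))ᗮ = ⊥ := by
  rw [Submodule.eq_bot_iff]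
  intro u hu
  have h0 : ∀ n : Fin d → ℤ, ∫ x, u x * hartley n x ∂torusMeasure d = 0 := fun n => by
    rw [← inner_contL2]
    exact hu _ (Submodule.subset_span ⟨n, rfl⟩)
  have hint : ∀ n : Fin d → ℤ, Integrable (fun x => u x * hartley n x) (torusMeasure d) :=
    fun n => integrable_mul_continuous u (map_continuous _)
  have hre : ∀ n : Fin d → ℤ, ∫ x, u x * (mFourier n x).re ∂torusMeasure d = 0 := fun n => by
    have h1 : ∀ x, u x * (mFourier n x).re =
        2⁻¹ * (u x * hartley n x + u x * hartley (-n) x) := fun x => by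
      simp only [hartley, ContinuousMap.coe_mk, mFourier_neg, Complex.conj_re, Complex.conj_im]
      ring
    simp only [h1]
    rw [integral_const_mul, integral_add (hint _) (hint _), h0, h0]
    simp
  have him : ∀ n : Fin d → ℤ, ∫ x, u x * (mFourier n x).im ∂torusMeasure d = 0 := fun n => by
    have h1 : ∀ x, u x * (mFourier n x).im =
        2⁻¹ * (u x * hartley n x - u x * hartley (-n) x) := fun x => by
      simp only [hartley, ContinuousMap.coe_mk, mFourier_neg, Complex.conj_re, Complex.conj_im]
      ring
    simp only [h1]
    rw [integral_const_mul, integral_sub (hint _) (hint _), h0, h0]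
    simp
  have hmem : MemLp (fun x => (u x : ℂ)) 2 (torusMeasure d) := (Lp.memLp u).ofReal
  have hcoef : ∀ n : Fin d → ℤ, ∫ x, mFourier n x * (u x : ℂ) ∂torusMeasure d = 0 := fun n => by
    have h1 : ∀ x, mFourier n x * (u x : ℂ) =
        ((u x * (mFourier n x).re : ℝ) : ℂ) + ((u x * (mFourier n x).im : ℝ) : ℂ) * Complex.I :=
      fun x => by
        conv_lhs => rw [← Complex.re_add_im (mFourier n x)]
        push_cast
        ring
    simp only [h1]
    rw [integral_add, integral_mul_const, integral_complex_ofReal, integral_complex_ofReal, hre,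
      him]
    · simp
    · exact (integrable_mul_continuous u (by fun_prop)).ofReal
    · exact (integrable_mul_continuous u (by fun_prop)).ofReal.mul_const _
  have hv : hmem.toLp _ = (0 : Lp ℂ 2 (torusMeasure d)) := by
    refine (mFourierBasis (d := Fin d)).repr.injective ?_
    rw [map_zero]
    ext n
    refine (mFourierBasis_repr _ n).trans ?_
    refine Eq.trans (integral_congr_ae ?_) (hcoef (-n))
    filter_upwards [hmem.coeFn_toLp] with x hx
    rw [hx, smul_eq_mul]
  have hz := hmem.coeFn_toLp
  rw [hv] at hz
  refine Lp.ext ?_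
  filter_upwards [hz, Lp.coeFn_zero ℂ 2 (torusMeasure d), Lp.coeFn_zero ℝ 2 (torusMeasure d)]
    with x h1 h2 h3
  rw [h3, Pi.zero_apply]
  rw [h2, Pi.zero_apply] at h1
  exact_mod_cast h1.symm

/-- The Hilbert basis of the real space `L²` consisting of the Hartley functions. -/
def hartleyBasis (d : ℕ) : HilbertBasis (Fin d → ℤ) ℝ (L2 d) :=
  HilbertBasis.mkOfOrthogonalEqBot orthonormal_hartleyL2 span_hartleyL2_orthogonal

lemma coe_hartleyBasis : ⇑(hartleyBasis d) = hartleyL2 :=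
  HilbertBasis.coe_mkOfOrthogonalEqBot _ _

end Torus

section Sobolev

variable {d : ℕ}

/-! ### Sobolev spaces in the Hartley basis -/

lemma isWeakPartial_hartleyL2 (n : Fin d → ℤ) (i : Fin d) :
    IsWeakPartial i (hartleyL2 n) ((2 * Real.pi * n i) • hartleyL2 (-n)) := by
  have h := isWeakPartial_contL2 (hartley_isSmooth n) (pderiv_hartley n i)
  rwa [show contL2 ((2 * Real.pi * n i) • hartley (-n)) = (2 * Real.pi * n i) • hartleyL2 (-n)
    from map_smul _ _ _] at h

/-- The map `v ↦ ∂_i v` from `H¹` to `L²`. -/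
def H1.partialL (i : Fin d) : H1 d →L[ℝ] L2 d :=
  ((PiLp.proj 2 (fun _ : Fin d => L2 d) (𝕜 := ℝ) i).comp
    (WithLp.sndL 2 ℝ (L2 d) (PiLp 2 fun _ : Fin d => L2 d))).comp (H1Submodule d).subtypeL

lemma H1.norm_sq_eq (v : H1 d) : ‖v‖ ^ 2 = ‖H1.toL2 v‖ ^ 2 + ∑ i, ‖H1.partialL i v‖ ^ 2 := by
  rw [Submodule.coe_norm, WithLp.prod_norm_sq_eq_of_L2, PiLp.norm_sq_eq_of_L2]
  rfl

/-- Weak differentiation is a closed operator. -/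
lemma isClosed_isWeakPartial {Y : Type*} [TopologicalSpace Y] {a b : Y → L2 d}
    (ha : Continuous a) (hb : Continuous b) (i : Fin d) :
    IsClosed {y | IsWeakPartial i (a y) (b y)} := by
  simp only [isWeakPartial_iff_inner, ofPred_forall]
  exact isClosed_iInter fun φ => isClosed_iInter fun hφ =>
    isClosed_eq (by fun_prop) (by fun_prop)

instance : CompleteSpace (H1 d) := by
  have h : IsClosed (H1Submodule d : Set (WithLp 2 (L2 d × PiLp 2 fun _ : Fin d => L2 d))) := by
    have h1 : (H1Submodule d : Set (WithLp 2 (L2 d × PiLp 2 fun _ : Fin d => L2 d))) =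
        ⋂ i, {p | IsWeakPartial i p.fst (p.snd i)} := by
      ext p
      rw [mem_iInter]
      rfl
    rw [h1]
    refine isClosed_iInter fun i => isClosed_isWeakPartial
      (WithLp.fstL 2 ℝ (L2 d) (PiLp 2 fun _ : Fin d => L2 d)).continuous ?_ i
    exact ((PiLp.proj 2 (fun _ : Fin d => L2 d) (𝕜 := ℝ) i).comp
      (WithLp.sndL 2 ℝ (L2 d) (PiLp 2 fun _ : Fin d => L2 d))).continuous
  exact h.completeSpace_coe

/-- The eigenvalue `4π²|n|²` of `-Δ` at the `n`-th Hartley function. -/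
def eigenvalue (n : Fin d → ℤ) : ℝ := ∑ i, (2 * Real.pi * n i) ^ 2

lemma eigenvalue_nonneg (n : Fin d → ℤ) : 0 ≤ eigenvalue n :=
  Finset.sum_nonneg fun _ _ => sq_nonneg _

lemma eigenvalue_neg (n : Fin d → ℤ) : eigenvalue (-n) = eigenvalue n := by
  simp [eigenvalue]

/-- The Hartley functions in `H¹`. -/
def hartleyH1 (n : Fin d → ℤ) : H1 d :=
  ⟨WithLp.toLp 2 (hartleyL2 n, WithLp.toLp 2 fun i => (2 * Real.pi * n i) • hartleyL2 (-n)),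
    isWeakPartial_hartleyL2 n⟩

lemma toL2_hartleyH1 (n : Fin d → ℤ) : H1.toL2 (hartleyH1 n) = hartleyBasis d n := by
  rw [coe_hartleyBasis]; rfl

lemma isPythagorean_neg :
    IsPythagorean (fun n : Fin d → ℤ => hartleyBasis d (-n)) fun _ => 1 := by
  have h := isPythagorean_of_pairwise (E := fun n : Fin d → ℤ => hartleyBasis d (-n))
    fun m n h => (hartleyBasis d).orthonormal.2 (neg_injective.ne h)
  simpa [(hartleyBasis d).orthonormal.1] using h

lemma partialL_hartleyH1 (i : Fin d) (n : Fin d → ℤ) :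
    H1.partialL i (hartleyH1 n) = (2 * Real.pi * n i) • hartleyBasis d (-n) := by
  rw [coe_hartleyBasis]; rfl

lemma isPythagorean_hartleyH1 :
    IsPythagorean (hartleyH1 (d := d)) fun n => 1 + eigenvalue n * 1 :=
  isPythagorean_of_norm_sq_eq H1.toL2 H1.partialL H1.norm_sq_eq
    (isPythagorean_basis (hartleyBasis d)) toL2_hartleyH1 isPythagorean_neg partialL_hartleyH1

lemma isPythagorean_hartleyH1_neg :
    IsPythagorean (fun n : Fin d → ℤ => hartleyH1 (-n)) fun n => 1 + eigenvalue n * 1 := by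
  have h := isPythagorean_hartleyH1.comp_injective (neg_injective (G := Fin d → ℤ))
  simpa only [eigenvalue_neg] using h

/-- Hartley coefficients of a weak derivative. -/
lemma inner_partialL (n : Fin d → ℤ) (i : Fin d) (v : H1 d) :
    inner ℝ (hartleyBasis d (-n)) (H1.partialL i v) =
      (2 * Real.pi * n i) * inner ℝ (hartleyBasis d n) (H1.toL2 v) := by
  have h2 := v.2 i (hartley (-n)) (hartley_isSmooth (-n))
  have h3 : ∀ x, pderiv i (hartley (-n)) x = -(2 * Real.pi * n i) * hartley n x := fun x => by
    rw [pderiv_hartley]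
    simp
  simp only [h3] at h2
  rw [coe_hartleyBasis, inner_contL2, inner_contL2]
  refine (neg_eq_iff_eq_neg.2 h2).symm.trans ?_
  rw [← integral_const_mul, ← integral_neg]
  refine integral_congr_ae (Eventually.of_forall fun x => ?_)
  change -(H1.toL2 v x * (-(2 * Real.pi * n i) * hartley n x)) = _
  ring

/-- The Hartley functions are weak eigenfunctions of `-Δ`. -/
lemma sum_inner_partial_hartleyH1 (n : Fin d → ℤ) (v : H1 d) :
    ∑ i, inner ℝ (H1.partialL i (hartleyH1 n)) (H1.partialL i v) =
      eigenvalue n * inner ℝ (hartleyBasis d n) (H1.toL2 v) := by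
  rw [eigenvalue, Finset.sum_mul]
  refine Finset.sum_congr rfl fun i _ => ?_
  rw [partialL_hartleyH1, real_inner_smul_left, inner_partialL]
  ring

/-- Bessel's inequality for the weak derivatives: the form `⟨-Δ θ, θ⟩` is finite on `H¹`. -/
lemma summable_eigenvalue_mul (θ : H1 d) :
    Summable fun n => eigenvalue n * inner ℝ (hartleyBasis d n) (H1.toL2 θ) ^ 2 := by
  simp only [eigenvalue, Finset.sum_mul, ← mul_pow]
  refine summable_sum fun i _ => ?_
  have h := (summable_inner_sq (hartleyBasis d) (θ := H1.partialL i θ)).comp_injective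
    (neg_injective (G := Fin d → ℤ))
  simpa only [Function.comp_def, inner_partialL] using h

lemma L2.toHNeg1_apply (u : L2 d) (v : H1 d) : L2.toHNeg1 u v = inner ℝ u (H1.toL2 v) := rfl

/-! ### The nonlinearity -/

/-- Composition with a Lipschitz function acts on `L²` as a Lipschitz map. -/
lemma exists_lipschitz_composition {f : ℝ → ℝ} {K : NNReal} (hf : LipschitzWith K f) :
    ∃ F : L2 d → L2 d, LipschitzWith K F ∧ ∀ u : L2 d, F u =ᵐ[torusMeasure d] fun x => f (u x) := by
  have hg : LipschitzWith K fun y => f y - f 0 :=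
    LipschitzWith.of_dist_le_mul fun x y => by simpa using hf.dist_le_mul x y
  have g0 : (fun y => f y - f 0) 0 = 0 := sub_self _
  refine ⟨fun u => hg.compLp g0 u + Lp.const 2 (torusMeasure d) (f 0), ?_, fun u => ?_⟩
  · exact LipschitzWith.of_dist_le_mul fun u v => by
      simpa using (hg.lipschitzWith_compLp g0).dist_le_mul u v
  · filter_upwards [Lp.coeFn_add (hg.compLp g0 u) (Lp.const 2 (torusMeasure d) (f 0)),
      hg.coeFn_compLp g0 u, Lp.coeFn_const (p := 2) (μ := torusMeasure d) (c := f 0)]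
      with x h1 h2 h3
    rw [h1, Pi.add_apply, h2, h3]
    simp

lemma inner_eq_integral_of_ae {g u : L2 d} {h : UnitAddTorus (Fin d) → ℝ}
    (hg : g =ᵐ[torusMeasure d] h) : inner ℝ g u = ∫ x, h x * u x ∂torusMeasure d := by
  rw [L2.inner_def]
  refine integral_congr_ae ?_
  filter_upwards [hg] with x hx
  rw [hx]
  exact mul_comm _ _

/-! ### Mild solutions and weak solutions -/

/-- A mild solution with initial value in `H¹` is a continuous and square integrable curve in
`H¹`. -/
lemma mild_H1 {T : ℝ} (hT : 0 ≤ T) (θ : H1 d) {g : ℝ → L2 d} (hg : Continuous g) :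
    ∃ U : ℝ → H1 d, ContinuousOn U (Icc 0 T) ∧ MemL2Time T U ∧ ∀ t ∈ Icc 0 T,
      HasSum (fun k => mildCoeff (hartleyBasis d) eigenvalue (H1.toL2 θ) g k t • hartleyH1 k)
        (U t) := by
  have hθ := summable_eigenvalue_mul θ
  obtain ⟨h1, h2⟩ := mild_continuousOn (hartleyBasis d) eigenvalue_nonneg hθ hg hT
    isPythagorean_hartleyH1 fun k => by rw [mul_one]
  obtain ⟨h3, -⟩ := mild_memL2Time (hartleyBasis d) eigenvalue_nonneg hθ hg hT
    isPythagorean_hartleyH1 fun k => by nlinarith [sq_nonneg (eigenvalue k - 1)]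
  exact ⟨_, h1, h3, h2⟩

/-- A square integrable curve in `L²` whose weak partial derivatives are square integrable curves
in `H¹` is a square integrable curve in `H²`. -/
lemma exists_memL2Time_H2 {T : ℝ} {u : ℝ → L2 d} {D : Fin d → ℝ → H1 d} (hu : MemL2Time T u)
    (hD : ∀ i, MemL2Time T (D i))
    (h : ∀ᵐ t ∂volume.restrict (Icc 0 T), ∀ i, IsWeakPartial i (u t) (H1.toL2 (D i t))) :
    ∃ V : ℝ → H2 d, MemL2Time T V ∧ ∀ᵐ t ∂volume.restrict (Icc 0 T), H2.toL2 (V t) = u t := by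
  classical
  let V : ℝ → H2 d := fun t =>
    if ht : ∀ i, IsWeakPartial i (u t) (H1.toL2 (D i t)) then
      ⟨WithLp.toLp 2 (u t, WithLp.toLp 2 fun i => D i t), ht⟩ else 0
  have hV : ∀ᵐ t ∂volume.restrict (Icc 0 T),
      (V t).1 = WithLp.toLp 2 (u t, WithLp.toLp 2 fun i => D i t) := by
    filter_upwards [h] with t ht
    simp only [V, dif_pos ht]
  refine ⟨V, memL2Time_of_coe ((memLp_congr_ae hV).2 (memL2Time_toLp hu hD)), ?_⟩
  filter_upwards [hV] with t ht
  exact congrArg WithLp.fst ht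

/-- The partial derivatives of a mild solution are square integrable with values in `H¹`. -/
lemma mild_partial_H1 {T : ℝ} (hT : 0 ≤ T) (θ : H1 d) {g : ℝ → L2 d} (hg : Continuous g)
    (i : Fin d) : ∃ D : ℝ → H1 d, MemL2Time T D ∧ ∀ᵐ t ∂volume.restrict (Icc 0 T),
      HasSum (fun k => mildCoeff (hartleyBasis d) eigenvalue (H1.toL2 θ) g k t •
        (2 * Real.pi * k i) • hartleyH1 (-k)) (D t) := by
  obtain ⟨h1, h2⟩ := mild_memL2Time (hartleyBasis d) eigenvalue_nonneg (summable_eigenvalue_mul θ)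
    hg hT (isPythagorean_hartleyH1_neg.smul fun k => 2 * Real.pi * k i) fun k => by
      have h1 : (2 * Real.pi * k i) ^ 2 ≤ eigenvalue k :=
        Finset.single_le_sum (f := fun i => (2 * Real.pi * k i) ^ 2) (fun _ _ => sq_nonneg _)
          (Finset.mem_univ i)
      -- `(2π k_i)² (1 + λ) ≤ λ + λ² ≤ 2 (1 + λ²)`
      nlinarith [sq_nonneg (eigenvalue k - 1), eigenvalue_nonneg k]
  exact ⟨_, h1, h2⟩

/-- The Dirichlet form against `v` of a function given by its Hartley series. -/
lemma hasSum_inner_partialL {c : (Fin d → ℤ) → ℝ} {U : H1 d}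
    (h : HasSum (fun k => c k • hartleyH1 k) U) (v : H1 d) :
    HasSum (fun k => c k * (eigenvalue k * inner ℝ (hartleyBasis d k) (H1.toL2 v)))
      (∑ i, inner ℝ (H1.partialL i U) (H1.partialL i v)) := by
  have h1 : ∀ i ∈ Finset.univ, HasSum
      (fun k => c k * inner ℝ (H1.partialL i (hartleyH1 k)) (H1.partialL i v))
      (inner ℝ (H1.partialL i U) (H1.partialL i v)) := fun i _ => by
    have h2 := (innerSL ℝ (H1.partialL i v)).hasSum ((H1.partialL i).hasSum h)
    simpa only [map_smul, innerSL_apply_apply, smul_eq_mul,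
      real_inner_comm _ (H1.partialL i v)] using h2
  simpa only [← Finset.mul_sum, sum_inner_partial_hartleyH1] using hasSum_sum h1

/-- A mild solution with initial value in `H¹` is a strong solution. -/
lemma isStrongSolution_of_mild {f : ℝ → ℝ} {T : ℝ} (hT : 0 ≤ T) (θ : H1 d) {u g : ℝ → L2 d}
    (hg : Continuous g) (hgu : ∀ t, g t =ᵐ[torusMeasure d] fun x => f (u t x))
    (hu : ∀ t ∈ Icc 0 T, u t = mild (hartleyBasis d) eigenvalue (H1.toL2 θ) g t) :
    IsStrongSolution f T (H1.toL2 θ) u := by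
  have hlam := eigenvalue_nonneg (d := d)
  have hθ := summable_eigenvalue_mul θ
  obtain ⟨U, hUcont, hUmem, hUsum⟩ := mild_H1 hT θ hg
  choose D hDmem hDsum using mild_partial_H1 hT θ hg
  set b := hartleyBasis d
  set c := mildCoeff b eigenvalue (H1.toL2 θ) g
  obtain ⟨hcont, hsum⟩ := mild_continuousOn b hlam hθ hg hT (isPythagorean_basis b)
    fun k => by linarith [hlam k]
  have hsum' : ∀ t ∈ Icc 0 T, HasSum (fun k => c k t • b k) (u t) := fun t ht => by
    rw [hu t ht]
    exact hsum t ht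
  have huc : ContinuousOn u (Icc 0 T) := hcont.congr hu
  have hcoef : ∀ k, ∀ t ∈ Icc 0 T, inner ℝ (b k) (u t) = c k t := fun k t ht =>
    inner_of_hasSum b (hsum' t ht) k
  obtain ⟨hwmem, hwsum⟩ := mild_deriv_memL2Time b hlam hθ hg hT
  have hw := isWeakTimeDeriv_mild b hlam hθ hg hT huc hcoef
  set w : ℝ → L2 d := fun t => ∑' k, (-eigenvalue k * c k t + inner ℝ (b k) (g t)) • b k
  have hU : ∀ t ∈ Icc 0 T, H1.toL2 (U t) = u t := fun t ht => by
    have h := H1.toL2.hasSum (hUsum t ht)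
    simp only [map_smul, toL2_hartleyH1] at h
    exact h.unique (hsum' t ht)
  have hUae : ∀ᵐ t ∂volume.restrict (Icc 0 T), H1.toL2 (U t) = u t :=
    (ae_restrict_iff' measurableSet_Icc).2 (Eventually.of_forall hU)
  have hDae : ∀ᵐ t ∂volume.restrict (Icc 0 T), ∀ i,
      IsWeakPartial i (u t) (H1.toL2 (D i t)) := by
    filter_upwards [ae_all_iff.2 hDsum, ae_restrict_mem measurableSet_Icc] with t hDt ht i
    have h1 := H1.toL2.hasSum (hDt i)
    have h2 := (H1.partialL i).hasSum (hUsum t ht)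
    simp only [map_smul, toL2_hartleyH1] at h1
    simp only [map_smul, partialL_hartleyH1] at h2
    rw [← hU t ht, h1.unique h2]
    exact (U t).2 i
  obtain ⟨V, hVmem, hVae⟩ := exists_memL2Time_H2
    ((memLp_congr_ae hUae).1 (H1.toL2.comp_memLp' hUmem)) hDmem hDae
  have h0 : u 0 = H1.toL2 θ := by
    refine ext_basis b fun k => ?_
    rw [hcoef k 0 (left_mem_Icc.2 hT)]
    exact duhamel_zero _ _ _
  have hweak : ∀ v : H1 d, ∀ᵐ t ∂volume.restrict (Icc 0 T),
      L2.toHNeg1 (w t) v + ∑ i, inner ℝ ((U t).partial i) (v.partial i) =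
        ∫ x, f (u t x) * H1.toL2 v x ∂(torusMeasure d) := fun v => by
    filter_upwards [hwsum, ae_restrict_mem measurableSet_Icc] with t hwt ht
    -- compare both sides coefficient by coefficient
    have e1 : HasSum (fun k => (-eigenvalue k * c k t + inner ℝ (b k) (g t)) *
        inner ℝ (b k) (H1.toL2 v)) (inner ℝ (w t) (H1.toL2 v)) := by
      have h := (innerSL ℝ (H1.toL2 v)).hasSum hwt
      simpa only [innerSL_apply_apply, real_inner_comm _ (H1.toL2 v),
        real_inner_smul_left] using h
    have e2 := hasSum_inner_partialL (hUsum t ht) v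
    have e3 : HasSum (fun k => inner ℝ (b k) (g t) * inner ℝ (b k) (H1.toL2 v))
        (inner ℝ (g t) (H1.toL2 v)) := by
      simpa only [real_inner_comm (b _) (g t)] using b.hasSum_inner_mul_inner (g t) (H1.toL2 v)
    rw [← inner_eq_integral_of_ae (hgu t), L2.toHNeg1_apply]
    exact (e1.add e2).unique (e3.congr_fun fun k => by ring)
  exact
    { continuousOn := huc
      initial := h0
      weak_eq := ⟨U, fun t => L2.toHNeg1 (w t), hUmem, hUae, hwmem.innerSL_comp H1.toL2,
        hw.innerSL_comp H1.toL2, hweak⟩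
      memL2_H2 := ⟨V, hVmem, hVae⟩
      continuousOn_H1 := ⟨U, hUcont, hU⟩
      deriv_memL2 := ⟨w, hwmem, hw⟩ }

/-- Testing the weak equation with the Hartley functions shows that a weak solution is a mild
solution. -/
lemma IsWeakSolution.eq_mild {f : ℝ → ℝ} {T : ℝ} (hT : 0 < T) {θ : L2 d} {v u g : ℝ → L2 d}
    (hv : IsWeakSolution f T θ v) (hu : Continuous u) (huv : EqOn v u (Icc 0 T))
    (hg : Continuous g) (hgu : ∀ t, g t =ᵐ[torusMeasure d] fun x => f (u t x)) :
    ∀ t ∈ Icc 0 T, u t = mild (hartleyBasis d) eigenvalue θ g t := by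
  obtain ⟨-, h0, U, w, -, hUv, -, hw, hweak⟩ := hv
  set b := hartleyBasis d
  have hcoef : ∀ k, ∀ t ∈ Icc 0 T, inner ℝ (b k) (u t) = mildCoeff b eigenvalue θ g k t := by
    intro k
    have h1 := hw.clm_comp (ContinuousLinearMap.apply ℝ ℝ (hartleyH1 k))
    have h2 : IsWeakTimeDeriv T (fun t => inner ℝ (b k) (u t))
        (fun t => -eigenvalue k * inner ℝ (b k) (u t) + inner ℝ (b k) (g t)) := by
      refine h1.congr ?_ ?_
      · filter_upwards [ae_restrict_mem measurableSet_Icc] with t ht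
        rw [← huv ht, real_inner_comm, ← toL2_hartleyH1]
        rfl
      · filter_upwards [ae_restrict_mem measurableSet_Icc, hUv, hweak (hartleyH1 k)] with t ht h3 h4
        have h5 : ∑ i, inner ℝ ((U t).partial i) ((hartleyH1 k).partial i) =
            eigenvalue k * inner ℝ (b k) (H1.toL2 (U t)) := by
          rw [← sum_inner_partial_hartleyH1]
          exact Finset.sum_congr rfl fun i _ => real_inner_comm _ _
        rw [huv ht] at h3 h4
        rw [h3] at h5
        rw [h5, ← inner_eq_integral_of_ae (hgu t), toL2_hartleyH1, real_inner_comm _ (g t)] at h4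
        change w t (hartleyH1 k) = _
        linarith
    have h3 := h2.eq_add_integral hT (by fun_prop) (by fun_prop)
    have h4 := eqOn_duhamel (by fun_prop) (by fun_prop) h3
    rw [← huv (left_mem_Icc.2 hT.le), h0] at h4
    exact h4
  intro t ht
  have h := b.hasSum_repr (u t)
  simp only [HilbertBasis.repr_apply_apply, hcoef _ t ht] at h
  exact h.tsum_eq.symm

end Sobolev

end ReactionDiffusion

end

open ReactionDiffusion in
theorem theorem3p1 (d : ℕ) (f : ℝ → ℝ) (hf : ContDiff ℝ ∞ f) (hfc : HasCompactSupport f)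
    (T : ℝ) (hT : 0 < T) (θ : H1 d) :
    ∃ u : ℝ → L2 d, IsStrongSolution f T (H1.toL2 θ) u ∧
      ∀ v : ℝ → L2 d, IsWeakSolution f T (H1.toL2 θ) v → Set.EqOn v u (Set.Icc 0 T) := by
  obtain ⟨K, hK⟩ := ContDiff.lipschitzWith_of_hasCompactSupport hfc hf (by simp)
  obtain ⟨F, hF, hFf⟩ := exists_lipschitz_composition (d := d) hK
  obtain ⟨u, hu, huniq⟩ := existsUnique_mild (hartleyBasis d) eigenvalue_nonneg
    (summable_eigenvalue_mul θ) hF hT.le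
  have hcont : ∀ x : C(Icc (0 : ℝ) T, L2 d), Continuous (IccExtend hT.le x) := fun x =>
    x.continuous.Icc_extend'
  refine ⟨IccExtend hT.le u, isStrongSolution_of_mild hT.le θ (hF.continuous.comp (hcont u))
    (fun t => hFf _) fun t ht => ?_, fun v hv => ?_⟩
  · rw [IccExtend_of_mem hT.le _ ht]
    exact hu ⟨t, ht⟩
  · let x : C(Icc (0 : ℝ) T, L2 d) :=
      ⟨(Icc 0 T).domRestrict v, continuousOn_iff_continuous_domRestrict.1 hv.continuousOn⟩
    have hxv : EqOn v (IccExtend hT.le x) (Icc 0 T) := fun t ht => by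
      rw [IccExtend_of_mem hT.le _ ht]
      rfl
    have hx := hv.eq_mild hT (hcont x) hxv (hF.continuous.comp (hcont x)) fun t => hFf _
    have hxu : x = u := huniq x fun t =>
      (IccExtend_of_mem hT.le x t.2).symm.trans (hx t t.2)
    rw [← hxu]
    exact hxv
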